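/- Let $R$ be a commutative Noetherian ring of prime characteristic $p>0$, and let $\mathfrak{a}\subseteq R$ be a perfect ideal, i.e. an ideal such that $\operatorname{grade}(\mathfrak{a})$, the maximal length of an $R$-regular sequence contained in $\mathfrak{a}$, is equal to the projective dimension of the $R$-module $R/\mathfrak{a}$ (in particular $\mathfrak{a}\neq R$, the zero module having projective dimension $-\infty$). Let $\operatorname{cd}(R,\mathfrak{a})$ denote the cohomological dimension of $\mathfrak{a}$, i.e. the least natural number $c$ such that the local cohomology modules $H^i_{\mathfrak{a}}(M)$ vanish for all $R$-modules $M$ and all $i>c$. Then $$\operatorname{cd}(R,\mathfrak{a})=\operatorname{ht}(\mathfrak{a}).$$ -/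

import Mathlib

universe u

/-- The grade of an ideal: the supremum of the lengths of the `R`-regular sequences
contained in it. -/
noncomputable def Ideal.grade {R : Type u} [CommRing R] (a : Ideal R) : ℕ∞ :=
  ⨆ (rs : List R) (_ : RingTheory.Sequence.IsRegular R rs ∧ ∀ r ∈ rs, r ∈ a),
    (rs.length : ℕ∞)

/-- An ideal `a` is perfect if its grade equals the projective dimension of `R ⧸ a`.
The zero module has projective dimension `⊥`, so a perfect ideal is proper. -/
def Ideal.IsPerfect {R : Type u} [CommRing R] (a : Ideal R) : Prop :=
  CategoryTheory.projectiveDimension (ModuleCat.of R (R ⧸ a)) = ((a.grade : ℕ∞) : WithBot ℕ∞)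

/-- The cohomological dimension of `a`: the least natural number `c` such that the local cohomology
modules `H^i_a(M)` vanish for all `R`-modules `M` and all `i > c` (and `⊤` if there is no
such `c`). -/
noncomputable def Ideal.cohomologicalDimension {R : Type u} [CommRing R] (a : Ideal R) : ℕ∞ :=
  ⨅ (c : ℕ) (_ : ∀ (M : ModuleCat.{u} R) (i : ℕ), c < i →
    CategoryTheory.Limits.IsZero ((localCohomology a i).obj M)), (c : ℕ∞)

universe v w w'

/-!
Let `g` be the grade of the perfect ideal `a`, attained by a regular sequence `rs`, so that a
resolution of the perfect module `R ⧸ a` has a projective syzygy in degree `g`. By the acyclicity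
lemma of Peskine and Szpiro the resolution stays exact after base change along a power of Frobenius,
so the Frobenius powers of `a` have projective dimension at most `g` as well. They are cofinal with
the ordinary powers, and `H^i_a(M)`, a colimit of `Ext^i(R ⧸ b, M)` over either system, vanishes
for `i > g`. In degree `g` the transition maps `Ext^g(R ⧸ aⁿ, M) ⟶ Ext^g(R ⧸ aᵏ, M)` are injective
for free `M`, because the kernel of `R ⧸ aᵏ ⟶ R ⧸ aⁿ` has no `Ext` into `M` below degree `g`; hence
`Ext^g(R ⧸ a, M) ≠ 0` survives in the colimit. Finally `ht a = g`: localising at a minimal prime of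
`a` gives a complex of length `g` with homology of finite length, and the length of its Frobenius
twists grows at most like `p ^ (e * g)`, which bounds the dimension of the local ring by `g`.
-/

section WeaklyRegular

open RingTheory.Sequence
open scoped Pointwise

variable {R : Type u} [CommRing R]

lemma isSMulRegular_quotient_of_notMem {q : Ideal R} [q.IsPrime] {x : R} (hx : x ∉ q) :
    IsSMulRegular (R ⧸ q) x :=
  (isSMulRegular_quotient_iff_mem_of_smul_mem q x).mpr fun _ hy ↦
    (Ideal.IsPrime.mem_or_mem ‹_› hy).resolve_left hx

lemma quotSMulTop_mk_eq_zero_iff {M : Type v} [AddCommGroup M] [Module R M] {r : R} {x : M} :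
    (Submodule.Quotient.mk x : QuotSMulTop r M) = 0 ↔ ∃ y, r • y = x := by
  rw [Submodule.Quotient.mk_eq_zero, Submodule.mem_smul_pointwise_iff_exists]
  simp

lemma mkQ_comp_quotSMulTop_eq_zero_iff {M : Type v} [AddCommGroup M] [Module R M] {r : R}
    {ι : Type*} {x : ι → M} :
    (r • (⊤ : Submodule R M)).mkQ ∘ x = 0 ↔ ∃ y : ι → M, r • y = x := by
  simp only [funext_iff, Function.comp_apply, Submodule.mkQ_apply, Pi.zero_apply, Pi.smul_apply]
  rw [← Classical.skolem (p := fun i y ↦ r • y = x i)]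
  exact forall_congr' fun i ↦ quotSMulTop_mk_eq_zero_iff

lemma subsingleton_quotSMulTop_of_isUnit (M : Type v) [AddCommGroup M] [Module R M] {r : R}
    (hr : IsUnit r) : Subsingleton (QuotSMulTop r M) := by
  refine subsingleton_of_forall_eq 0 fun x ↦ ?_
  obtain ⟨x, rfl⟩ := Submodule.Quotient.mk_surjective _ x
  exact quotSMulTop_mk_eq_zero_iff.mpr ⟨hr.unit⁻¹ • x, smul_inv_smul hr.unit x⟩

lemma quotSMulTop_map_injective {M M' M'' : Type*} [AddCommGroup M] [Module R M]
    [AddCommGroup M'] [Module R M'] [AddCommGroup M''] [Module R M''] {r : R}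
    {f : M →ₗ[R] M'} {g : M' →ₗ[R] M''} (hf : Function.Injective f) (hfg : Function.Exact f g)
    (hr : IsSMulRegular M'' r) : Function.Injective (QuotSMulTop.map r f) := by
  rw [injective_iff_map_eq_zero]
  intro x hx
  obtain ⟨x, rfl⟩ := Submodule.Quotient.mk_surjective _ x
  rw [QuotSMulTop.map_apply_mk, quotSMulTop_mk_eq_zero_iff] at hx
  obtain ⟨y, hy⟩ := hx
  have hgy : g y = 0 := hr.right_eq_zero_of_smul <| by
    rw [← map_smul, hy, hfg.apply_apply_eq_zero]
  obtain ⟨z, rfl⟩ := (hfg y).mp hgy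
  exact quotSMulTop_mk_eq_zero_iff.mpr ⟨z, hf (by rw [map_smul, hy])⟩

lemma exists_exact_quotSMulTop_mul {N : Type v} [AddCommGroup N] [Module R N] {x : R}
    (hx : IsSMulRegular N x) (y : R) :
    ∃ (f : QuotSMulTop y N →ₗ[R] QuotSMulTop (x * y) N)
      (g : QuotSMulTop (x * y) N →ₗ[R] QuotSMulTop x N),
      Function.Injective f ∧ Function.Surjective g ∧ Function.Exact f g := by
  let f : QuotSMulTop y N →ₗ[R] QuotSMulTop (x * y) N :=
    Submodule.mapQ _ _ (LinearMap.lsmul R N x) (by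
      rintro _ ⟨z, -, rfl⟩
      exact ⟨z, trivial, mul_smul x y z⟩)
  let g : QuotSMulTop (x * y) N →ₗ[R] QuotSMulTop x N :=
    Submodule.mapQ _ _ LinearMap.id (by
      rintro _ ⟨z, -, rfl⟩
      exact ⟨y • z, trivial, (mul_smul x y z).symm⟩)
  have hf (z : N) : f (Submodule.Quotient.mk z) = Submodule.Quotient.mk (x • z) := rfl
  have hg (z : N) : g (Submodule.Quotient.mk z) = Submodule.Quotient.mk z := rfl
  refine ⟨f, g, (injective_iff_map_eq_zero f).mpr fun z hz ↦ ?_, fun z ↦ ?_, fun z ↦ ?_⟩ <;>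
    obtain ⟨z, rfl⟩ := Submodule.Quotient.mk_surjective _ z
  · obtain ⟨t, ht⟩ := quotSMulTop_mk_eq_zero_iff.mp hz
    exact quotSMulTop_mk_eq_zero_iff.mpr ⟨t, hx (by simpa [mul_smul] using ht)⟩
  · exact ⟨Submodule.Quotient.mk z, hg z⟩
  · rw [hg, quotSMulTop_mk_eq_zero_iff]
    constructor
    · rintro ⟨t, rfl⟩
      exact ⟨Submodule.Quotient.mk t, hf t⟩
    · rintro ⟨t, ht⟩
      obtain ⟨t, rfl⟩ := Submodule.Quotient.mk_surjective _ t
      obtain ⟨s, hs⟩ := (Submodule.Quotient.eq _).mp (ht.symm.trans (hf t))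
      exact ⟨t + y • s, by rw [smul_add, smul_smul]; exact (eq_add_of_sub_eq' hs.2.symm).symm⟩

lemma isWeaklyRegular_of_subsingleton (M : Type v) [AddCommGroup M] [Module R M] [Subsingleton M]
    (rs : List R) : IsWeaklyRegular M rs :=
  ⟨fun _ _ ↦ Function.injective_of_subsingleton _⟩

lemma isWeaklyRegular_of_exact {M M' M'' : Type*} [AddCommGroup M] [Module R M]
    [AddCommGroup M'] [Module R M'] [AddCommGroup M''] [Module R M''] {rs : List R}
    {f : M →ₗ[R] M'} {g : M' →ₗ[R] M''} (hf : Function.Injective f) (hg : Function.Surjective g)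
    (hfg : Function.Exact f g) (h : IsWeaklyRegular M rs) (h'' : IsWeaklyRegular M'' rs) :
    IsWeaklyRegular M' rs := by
  induction rs generalizing M M' M'' with
  | nil => simp
  | cons r rs ih =>
    rw [isWeaklyRegular_cons_iff] at h h'' ⊢
    exact ⟨isSMulRegular_of_range_eq_ker hf hfg.linearMap_ker_eq.symm h.1 h''.1,
      ih (quotSMulTop_map_injective hf hfg h''.1)
        (QuotSMulTop.map_surjective r hg) (QuotSMulTop.map_exact r hfg hg) h.2 h''.2⟩

lemma isWeaklyRegular_quotSMulTop_pow {M : Type v} [AddCommGroup M] [Module R M] {r : R}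
    {rs : List R} (hr : IsSMulRegular M r) (h : IsWeaklyRegular (QuotSMulTop r M) rs) (n : ℕ) :
    IsWeaklyRegular (QuotSMulTop (r ^ n) M) rs := by
  induction n with
  | zero =>
    have := subsingleton_quotSMulTop_of_isUnit M (r := r ^ 0) (by simp)
    exact isWeaklyRegular_of_subsingleton _ _
  | succ n ih =>
    obtain ⟨f, g, hf, hg, hfg⟩ := exists_exact_quotSMulTop_mul hr (r ^ n)
    rw [pow_succ']
    exact isWeaklyRegular_of_exact hf hg hfg ih h

lemma isWeaklyRegular_map_pow {M : Type v} [AddCommGroup M] [Module R M] {rs : List R}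
    (h : IsWeaklyRegular M rs) (n : ℕ) : IsWeaklyRegular M (rs.map (· ^ n)) := by
  induction rs generalizing M with
  | nil => simp
  | cons r rs ih =>
    rw [isWeaklyRegular_cons_iff] at h
    rw [List.map_cons, isWeaklyRegular_cons_iff]
    exact ⟨h.1.pow n, ih (isWeaklyRegular_quotSMulTop_pow h.1 h.2 n)⟩

end WeaklyRegular

section Length

open Module

variable {R : Type u} [CommRing R] {X Y Z : Type*} [AddCommGroup X] [Module R X]
  [AddCommGroup Y] [Module R Y] [AddCommGroup Z] [Module R Z]

lemma length_le_of_ker_le (α : Z →ₗ[R] X) (β : Z →ₗ[R] Y) (hα : Function.Surjective α)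
    (h : LinearMap.ker β ≤ LinearMap.ker α) : length R X ≤ length R Y :=
  calc length R X
      ≤ length R (Z ⧸ LinearMap.ker β) :=
        length_le_of_surjective ((LinearMap.ker β).liftQ α h) <| by
          rwa [← LinearMap.range_eq_top, Submodule.range_liftQ, LinearMap.range_eq_top]
    _ = length R (LinearMap.range β) := β.quotKerEquivRange.length_eq
    _ ≤ length R Y := length_le_of_injective _ (Submodule.subtype_injective _)

lemma length_le_add_of_exact (f : X →ₗ[R] Y) (g : Y →ₗ[R] Z) (h : Function.Exact f g) :
    length R Y ≤ length R X + length R Z := by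
  rw [length_eq_add_of_exact (LinearMap.ker g).subtype g.rangeRestrict
    (Submodule.subtype_injective _) g.surjective_rangeRestrict (by
      rw [LinearMap.exact_iff, LinearMap.ker_rangeRestrict, Submodule.range_subtype])]
  gcongr
  · rw [h.linearMap_ker_eq]
    exact length_le_of_surjective f.rangeRestrict f.surjective_rangeRestrict
  · exact length_le_of_injective _ (Submodule.subtype_injective _)

end Length

section SmulVec

open Matrix

variable {R : Type u} [CommRing R] {l m n k : Type*} [Fintype n]

/-- The linear map `Nⁿ → Nᵐ` given by an `m × n` matrix over `R`, where `N` is an `R`-module. This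
is `Matrix.mulVecLin` for vectors with entries in a module, that is, the tensor product of
`Matrix.mulVecLin A` with `N`. -/
def smulVecLin (N : Type v) [AddCommGroup N] [Module R N] (A : Matrix m n R) :
    (n → N) →ₗ[R] (m → N) where
  toFun v i := ∑ j, A i j • v j
  map_add' v w := by ext i; simp [smul_add, Finset.sum_add_distrib]
  map_smul' c v := by ext i; simp [Finset.smul_sum, smul_comm c]

variable {N : Type v} [AddCommGroup N] [Module R N]

lemma smulVecLin_apply (A : Matrix m n R) (v : n → N) (i : m) :
    smulVecLin N A v i = ∑ j, A i j • v j := rfl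

lemma smulVecLin_mul [Fintype m] (A : Matrix l m R) (B : Matrix m n R) (v : n → N) :
    smulVecLin N (A * B) v = smulVecLin N A (smulVecLin N B v) := by
  ext i
  simp only [smulVecLin_apply, mul_apply, Finset.sum_smul, Finset.smul_sum, mul_smul]
  exact Finset.sum_comm

lemma smulVecLin_add (A B : Matrix m n R) (v : n → N) :
    smulVecLin N (A + B) v = smulVecLin N A v + smulVecLin N B v := by
  ext i; simp [smulVecLin_apply, add_smul, Finset.sum_add_distrib]

lemma smulVecLin_zero (v : n → N) : smulVecLin N (0 : Matrix m n R) v = 0 := by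
  ext i; simp [smulVecLin_apply]

lemma smulVecLin_smul_one [DecidableEq n] (x : R) (v : n → N) :
    smulVecLin N (x • (1 : Matrix n n R)) v = x • v := by
  ext i; simp [smulVecLin_apply, one_apply]

lemma smulVecLin_comp {N' : Type w} [AddCommGroup N'] [Module R N'] (f : N →ₗ[R] N')
    (A : Matrix m n R) (v : n → N) : smulVecLin N' A (f ∘ v) = f ∘ smulVecLin N A v := by
  ext i; simp [smulVecLin_apply]

lemma exists_mul_eq_of_forall_mem_range (B : Matrix m n R) (C : Matrix m k R)
    (h : ∀ j, C.col j ∈ LinearMap.range (smulVecLin R B)) : ∃ X : Matrix n k R, B * X = C := by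
  choose X hX using h
  refine ⟨.of fun i j ↦ X j i, ?_⟩
  ext i j
  exact congrFun (hX j) i

lemma exists_mul_eq_of_exact [Fintype m] {A : Matrix l m R} {B : Matrix m n R}
    (h : Function.Exact (smulVecLin R B) (smulVecLin R A)) (C : Matrix m k R) (hC : A * C = 0) :
    ∃ X : Matrix n k R, B * X = C :=
  exists_mul_eq_of_forall_mem_range B C fun j ↦ (h _).mp <| funext fun i ↦
    congrFun (congrFun hC i) j

lemma mul_eq_zero_of_exact [Fintype m] {A : Matrix l m R} {B : Matrix m n R}
    (h : Function.Exact (smulVecLin R B) (smulVecLin R A)) : A * B = 0 := by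
  classical
  refine mulVec_injective (funext fun v ↦ ?_)
  rw [zero_mulVec, ← mulVec_mulVec]
  exact h.apply_apply_eq_zero v

end SmulVec

/-- A complex `⋯ → R^{ι 2} → R^{ι 1} → R^{ι 0}` of finite free modules with chosen bases, given by
the matrices of its differentials. Matrices, rather than linear maps, make base change along a ring
homomorphism (in particular along Frobenius) an entrywise operation.

The homology at `ι (i + 1)` is that at *degree* `i`, so that every degree has both an outgoing
differential `d i` and an incoming one `d (i + 1)`. -/
structure MatrixComplex (R : Type u) [CommRing R] where
  ι : ℕ → Type
  [fintype : ∀ i, Fintype (ι i)]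
  [decidableEq : ∀ i, DecidableEq (ι i)]
  d (i : ℕ) : Matrix (ι i) (ι (i + 1)) R
  d_mul_d (i : ℕ) : d i * d (i + 1) = 0

namespace MatrixComplex

attribute [instance] fintype decidableEq

variable {R : Type u} [CommRing R] (K : MatrixComplex R)

/-- The base change of a complex of finite free modules along a ring homomorphism. -/
def map {S : Type v} [CommRing S] (φ : R →+* S) : MatrixComplex S where
  ι := K.ι
  d i := (K.d i).map φ
  d_mul_d i := by rw [← Matrix.map_mul, K.d_mul_d, Matrix.map_zero _ (map_zero φ)]

/-- The differential `N^{ι (i + 1)} → N^{ι i}` of the tensor product of `K` with `N`. -/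
abbrev diff (N : Type v) [AddCommGroup N] [Module R N] (i : ℕ) :
    (K.ι (i + 1) → N) →ₗ[R] (K.ι i → N) :=
  smulVecLin N (K.d i)

/-- Exactness of the tensor product of `K` with `N` in degree `i`. -/
def ExactAt (N : Type v) [AddCommGroup N] [Module R N] (i : ℕ) : Prop :=
  Function.Exact (K.diff N (i + 1)) (K.diff N i)

/-- Multiplication by `x` on `K` satisfies the equation of a null-homotopy in degree `i`. -/
def IsNullAt (x : R) (i : ℕ) : Prop :=
  ∃ (s : Matrix (K.ι (i + 1)) (K.ι i) R) (t : Matrix (K.ι (i + 2)) (K.ι (i + 1)) R),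
    K.d (i + 1) * t + s * K.d i = x • 1

/-- The homology of the tensor product of `K` with `N` in degree `i`. -/
abbrev Homology (N : Type v) [AddCommGroup N] [Module R N] (i : ℕ) : Type v :=
  LinearMap.ker (K.diff N i) ⧸ (LinearMap.range (K.diff N (i + 1))).submoduleOf
    (LinearMap.ker (K.diff N i))

variable {K} {N : Type v} [AddCommGroup N] [Module R N] {i : ℕ}

lemma diff_diff (v : K.ι (i + 2) → N) : K.diff N i (K.diff N (i + 1) v) = 0 := by
  rw [← smulVecLin_mul, K.d_mul_d, smulVecLin_zero]

lemma exactAt_iff : K.ExactAt N i ↔ ∀ z, K.diff N i z = 0 → ∃ w, K.diff N (i + 1) w = z := by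
  refine forall_congr' fun z ↦ ⟨Iff.mp, fun h ↦ ⟨h, ?_⟩⟩
  rintro ⟨w, rfl⟩
  exact diff_diff w

namespace IsNullAt

variable {x : R}

lemma map {S : Type w} [CommRing S] (φ : R →+* S) (h : K.IsNullAt x i) :
    (K.map φ).IsNullAt (φ x) i := by
  obtain ⟨s, t, h⟩ := h
  refine ⟨s.map φ, t.map φ, ?_⟩
  calc (K.d (i + 1)).map φ * t.map φ + s.map φ * (K.d i).map φ
      = (x • (1 : Matrix (K.ι (i + 1)) _ R)).map φ := by
        rw [← Matrix.map_mul, ← Matrix.map_mul, ← Matrix.map_add _ (map_add φ), h]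
    _ = φ x • 1 := by
        rw [Matrix.map_smul' _ _ _ (map_mul φ), Matrix.map_one φ (map_zero φ) (map_one φ)]

lemma exists_diff_eq_smul (h : K.IsNullAt x i) {z : K.ι (i + 1) → N} (hz : K.diff N i z = 0) :
    ∃ w, K.diff N (i + 1) w = x • z := by
  obtain ⟨s, t, h⟩ := h
  refine ⟨smulVecLin N t z, ?_⟩
  rw [← smulVecLin_smul_one x z, ← h, smulVecLin_add, smulVecLin_mul, smulVecLin_mul, hz,
    map_zero, add_zero]

lemma exactAt (h : K.IsNullAt 1 i) : K.ExactAt N i :=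
  exactAt_iff.mpr fun z hz ↦ by simpa using h.exists_diff_eq_smul hz

lemma succ (h : K.IsNullAt x i) (hK : K.ExactAt R (i + 1)) : K.IsNullAt x (i + 1) := by
  obtain ⟨s, t, h⟩ := h
  obtain ⟨t', ht'⟩ := exists_mul_eq_of_exact hK (x • 1 - t * K.d (i + 1)) (by
    rw [Matrix.mul_sub, ← Matrix.mul_assoc, eq_sub_of_add_eq h, Matrix.sub_mul, Matrix.mul_assoc,
      K.d_mul_d]
    simp)
  exact ⟨t, t', by rw [ht', sub_add_cancel]⟩

end IsNullAt

namespace Homology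

/-- The homology class of a cycle. -/
def mk (z : K.ι (i + 1) → N) (hz : K.diff N i z = 0) : K.Homology N i :=
  Submodule.Quotient.mk ⟨z, hz⟩

lemma exists_eq_mk (x : K.Homology N i) : ∃ z hz, x = mk z hz := by
  obtain ⟨⟨z, hz⟩, rfl⟩ := Submodule.Quotient.mk_surjective _ x
  exact ⟨z, hz, rfl⟩

lemma mk_eq_zero_iff {z : K.ι (i + 1) → N} {hz : K.diff N i z = 0} :
    (mk z hz : K.Homology N i) = 0 ↔ ∃ w, K.diff N (i + 1) w = z := by
  rw [mk, Submodule.Quotient.mk_eq_zero]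
  rfl

/-- The map on homology induced by a linear map of the coefficient modules. -/
def map {N' : Type w} [AddCommGroup N'] [Module R N'] (f : N →ₗ[R] N') :
    K.Homology N i →ₗ[R] K.Homology N' i :=
  Submodule.mapQ _ _
    ((f.compLeft (K.ι (i + 1))).restrict fun z hz ↦ by
      change smulVecLin N' _ (f ∘ z) = 0
      rw [smulVecLin_comp, LinearMap.mem_ker.mp hz]
      ext
      simp)
    (by
      rintro ⟨z, hz⟩ ⟨w, hw⟩
      exact ⟨f ∘ w, by rw [smulVecLin_comp, hw]; rfl⟩)

lemma map_mk {N' : Type w} [AddCommGroup N'] [Module R N'] (f : N →ₗ[R] N')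
    (z : K.ι (i + 1) → N) (hz : K.diff N i z = 0) :
    map f (mk z hz : K.Homology N i) =
      mk (f ∘ z) (by rw [smulVecLin_comp, hz]; ext; simp) := rfl

lemma length_le_of_linearEquiv {N' : Type*} [AddCommGroup N'] [Module R N'] (φ : N ≃ₗ[R] N') :
    Module.length R (K.Homology N' i) ≤ Module.length R (K.Homology N i) := by
  refine Module.length_le_of_surjective (map φ.toLinearMap) fun x ↦ ?_
  obtain ⟨z, hz, rfl⟩ := exists_eq_mk x
  have hz' : K.diff N i (φ.symm.toLinearMap ∘ z) = 0 := by
    rw [smulVecLin_comp, hz]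
    ext
    simp
  exact ⟨mk _ hz', congrArg Submodule.Quotient.mk <| Subtype.ext <| funext fun j ↦
    φ.apply_symm_apply (z j)⟩

section exact

variable {N₁ : Type*} {N₂ : Type*} {N₃ : Type*} [AddCommGroup N₁] [Module R N₁] [AddCommGroup N₂]
  [Module R N₂] [AddCommGroup N₃] [Module R N₃] {f : N₁ →ₗ[R] N₂} {g : N₂ →ₗ[R] N₃}

lemma map_exact (hf : Function.Injective f) (hg : Function.Surjective g)
    (hfg : Function.Exact f g) :
    Function.Exact (map f : K.Homology N₁ i →ₗ[R] _) (map g) := by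
  intro x
  obtain ⟨z, hz, rfl⟩ := exists_eq_mk x
  constructor
  · intro h
    obtain ⟨w, hw⟩ := mk_eq_zero_iff.mp h
    obtain ⟨w, rfl⟩ := hg.comp_left w
    have hgz : g ∘ (z - K.diff N₂ (i + 1) w) = 0 := by
      rw [smulVecLin_comp] at hw
      ext j
      simpa [sub_eq_zero] using (congrFun hw j).symm
    choose y hy using fun j ↦ (hfg _).mp (congrFun hgz j)
    obtain hy : f ∘ y = z - K.diff N₂ (i + 1) w := funext hy
    have hdy : K.diff N₁ i y = 0 := by
      have hfy : f ∘ K.diff N₁ i y = 0 := by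
        rw [← smulVecLin_comp, hy, map_sub, hz, diff_diff, sub_zero]
      exact funext fun j ↦ hf (by simpa using congrFun hfy j)
    refine ⟨mk y hdy, (Submodule.Quotient.eq _).mpr ⟨-w, ?_⟩⟩
    change _ = f ∘ y - z
    rw [map_neg, hy, sub_sub_cancel_left]
  · rintro ⟨x, hx⟩
    obtain ⟨y, hy, rfl⟩ := exists_eq_mk x
    rw [← hx, map_mk, map_mk, mk_eq_zero_iff]
    refine ⟨0, ?_⟩
    ext j
    simp [hfg.apply_apply_eq_zero]

lemma length_le_add (hf : Function.Injective f) (hg : Function.Surjective g)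
    (hfg : Function.Exact f g) :
    Module.length R (K.Homology N₂ i) ≤
      Module.length R (K.Homology N₁ i) + Module.length R (K.Homology N₃ i) :=
  length_le_add_of_exact _ _ (map_exact hf hg hfg)

end exact

lemma length_le_card_mul :
    Module.length R (K.Homology N i) ≤ Fintype.card (K.ι (i + 1)) * Module.length R N :=
  calc Module.length R (K.Homology N i)
      ≤ Module.length R (LinearMap.ker (K.diff N i)) :=
        Module.length_le_of_surjective _ (Submodule.mkQ_surjective _)
    _ ≤ Module.length R (K.ι (i + 1) → N) :=
        Module.length_le_of_injective _ (Submodule.subtype_injective _)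
    _ = Fintype.card (K.ι (i + 1)) * Module.length R N := by simp

lemma length_eq_zero_iff_exactAt : Module.length R (K.Homology N i) = 0 ↔ K.ExactAt N i := by
  rw [Module.length_eq_zero_iff, exactAt_iff]
  refine ⟨fun _ z hz ↦ mk_eq_zero_iff.mp (Subsingleton.elim (mk z hz) 0),
    fun h ↦ subsingleton_of_forall_eq 0 fun x ↦ ?_⟩
  obtain ⟨z, hz, rfl⟩ := exists_eq_mk x
  exact mk_eq_zero_iff.mpr (h z hz)

end Homology

open scoped Pointwise

section Shift

variable {y : R}

lemma exists_diff_eq_of_exists_diff_quotSMulTop_eq (hy : IsSMulRegular N y)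
    {z : K.ι (i + 1) → N} {w : K.ι (i + 2) → N} (hw : K.diff N (i + 1) w = y • z)
    (h : ∃ v, K.diff (QuotSMulTop y N) (i + 2) v = (y • (⊤ : Submodule R N)).mkQ ∘ w) :
    ∃ u, K.diff N (i + 1) u = z := by
  obtain ⟨v, hv⟩ := h
  obtain ⟨v, rfl⟩ := (Submodule.mkQ_surjective _).comp_left v
  obtain ⟨u, hu⟩ : ∃ u, y • u = w - K.diff N (i + 2) v := by
    rw [← mkQ_comp_quotSMulTop_eq_zero_iff]
    ext j
    simpa [smulVecLin_comp, sub_eq_zero] using (congrFun hv j).symm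
  refine ⟨u, IsSMulRegular.pi (fun _ ↦ hy) ?_⟩
  change y • _ = y • _
  rw [← map_smul, hu, map_sub, diff_diff, sub_zero, hw]

lemma length_homology_le_of_isSMulRegular (hy : IsSMulRegular N y) (hn : K.IsNullAt y i) :
    Module.length R (K.Homology N i) ≤ Module.length R (K.Homology (QuotSMulTop y N) (i + 1)) := by
  -- `y` annihilates `H_i(K ⊗ N)`, so the connecting homomorphism `H_{i+1}(K ⊗ N/yN) → H_i(K ⊗ N)`
  -- is surjective; `Z` is its graph on the level of chains.
  let Z : Submodule R ((K.ι (i + 2) → N) × (K.ι (i + 1) → N)) :=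
    LinearMap.ker ((K.diff N (i + 1)).comp (LinearMap.fst R _ _) - y • LinearMap.snd R _ _)
  have hZ (z : Z) : K.diff N (i + 1) z.1.1 = y • z.1.2 := sub_eq_zero.mp z.2
  have hZ₂ (z : Z) : K.diff N i z.1.2 = 0 := by
    refine IsSMulRegular.pi (fun _ ↦ hy) ?_
    change y • _ = y • _
    rw [← map_smul, ← hZ, diff_diff, smul_zero]
  have hZ₁ (z : Z) :
      K.diff (QuotSMulTop y N) (i + 1) ((y • (⊤ : Submodule R N)).mkQ ∘ z.1.1) = 0 :=
    (smulVecLin_comp _ _ _).trans (mkQ_comp_quotSMulTop_eq_zero_iff.mpr ⟨_, (hZ z).symm⟩)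
  let α : Z →ₗ[R] K.Homology N i :=
    { toFun z := Homology.mk z.1.2 (hZ₂ z)
      map_add' _ _ := rfl
      map_smul' _ _ := rfl }
  let β : Z →ₗ[R] K.Homology (QuotSMulTop y N) (i + 1) :=
    { toFun z := Homology.mk _ (hZ₁ z)
      map_add' _ _ := rfl
      map_smul' _ _ := rfl }
  refine length_le_of_ker_le α β (fun x ↦ ?_) (fun z hz ↦ ?_)
  · obtain ⟨z, hz, rfl⟩ := Homology.exists_eq_mk x
    obtain ⟨w, hw⟩ := hn.exists_diff_eq_smul hz
    exact ⟨⟨(w, z), sub_eq_zero.mpr hw⟩, rfl⟩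
  · exact Homology.mk_eq_zero_iff.mpr
      (exists_diff_eq_of_exists_diff_quotSMulTop_eq hy (hZ z) (Homology.mk_eq_zero_iff.mp hz))

theorem exactAt_of_isWeaklyRegular {g : ℕ} (hg : ∀ i, g < i → K.IsNullAt 1 i) {rs : List R}
    (hrs : ∀ y ∈ rs, ∀ i, K.IsNullAt y i) (h : RingTheory.Sequence.IsWeaklyRegular N rs)
    (hi : g < i + rs.length) : K.ExactAt N i := by
  induction rs generalizing N i with
  | nil => exact (hg i hi).exactAt
  | cons y rs ih =>
    rw [RingTheory.Sequence.isWeaklyRegular_cons_iff] at h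
    have hq : K.ExactAt (QuotSMulTop y N) (i + 1) :=
      ih (fun z hz ↦ hrs z (by simp [hz])) h.2 (by simp at hi; omega)
    rw [← Homology.length_eq_zero_iff_exactAt] at hq ⊢
    exact le_zero_iff.mp (hq ▸ length_homology_le_of_isSMulRegular h.1 (hrs y (by simp) i))

lemma length_homology_quotSMulTop_pow_le {x : R} (hx : IsSMulRegular N x) (n : ℕ) :
    Module.length R (K.Homology (QuotSMulTop (x ^ n) N) i) ≤
      n * Module.length R (K.Homology (QuotSMulTop x N) i) := by
  induction n with
  | zero =>
    have := subsingleton_quotSMulTop_of_isUnit N (r := x ^ 0) (by simp)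
    refine Homology.length_le_card_mul.trans ?_
    simp [Module.length_eq_zero]
  | succ n ih =>
    obtain ⟨f, g, hf, hg, hfg⟩ := exists_exact_quotSMulTop_mul hx (x ^ n)
    rw [pow_succ', Nat.cast_succ, add_mul, one_mul]
    exact (Homology.length_le_add hf hg hfg).trans (add_le_add_left ih _)

end Shift

section Growth

variable {A : Type u} [CommRing A]

lemma length_homology_frobenius_le (p : ℕ) [ExpChar A p] {K : MatrixComplex A} {N : Type v}
    [AddCommGroup N] [Module A N] {x : A} {i : ℕ} (hx : IsSMulRegular N x) (h : K.IsNullAt x i)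
    (e : ℕ) :
    Module.length A ((K.map (iterateFrobenius A p e)).Homology N i) ≤
      (p ^ e : ℕ) *
        Module.length A ((K.map (iterateFrobenius A p e)).Homology (QuotSMulTop x N) (i + 1)) := by
  have hnull : (K.map (iterateFrobenius A p e)).IsNullAt (x ^ p ^ e) i := by
    simpa [iterateFrobenius_def] using h.map (iterateFrobenius A p e)
  exact (length_homology_le_of_isSMulRegular (hx.pow _) hnull).trans
    (length_homology_quotSMulTop_pow_le hx _)

lemma exists_length_homology_le_of_quotient_prime [IsNoetherianRing A] (K : ℕ → MatrixComplex A)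
    (f : ℕ → ℕ) (i : ℕ)
    (h : ∀ q : PrimeSpectrum A, ∃ c : ℕ, ∀ e,
      Module.length A ((K e).Homology (A ⧸ q.asIdeal) i) ≤ (c * f e : ℕ))
    (N : Type u) [AddCommGroup N] [Module A N] [Module.Finite A N] :
    ∃ c : ℕ, ∀ e, Module.length A ((K e).Homology N i) ≤ (c * f e : ℕ) := by
  induction ‹Module.Finite A N› using
    IsNoetherianRing.induction_on_isQuotientEquivQuotientPrime A with
  | subsingleton N =>
    refine ⟨0, fun e ↦ Homology.length_le_card_mul.trans ?_⟩
    simp [Module.length_eq_zero]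
  | quotient N q φ =>
    obtain ⟨c, hc⟩ := h q
    exact ⟨c, fun e ↦ (Homology.length_le_of_linearEquiv φ.symm).trans (hc e)⟩
  | exact N₁ N₂ N₃ φ ψ hφ hψ hφψ h₁ h₃ =>
    obtain ⟨c₁, h₁⟩ := h₁
    obtain ⟨c₃, h₃⟩ := h₃
    refine ⟨c₁ + c₃, fun e ↦ (Homology.length_le_add hφ hψ hφψ).trans ?_⟩
    rw [add_mul, Nat.cast_add]
    exact add_le_add (h₁ e) (h₃ e)

open IsLocalRing in
lemma exists_length_homology_frobenius_le_of_succ [IsNoetherianRing A] [IsLocalRing A] (p : ℕ)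
    [ExpChar A p] {K : MatrixComplex A} {I : Set A} {i : ℕ} (hI : ∀ x ∈ I, K.IsNullAt x i)
    (hIm : ∀ q : Ideal A, q.IsPrime → I ⊆ q → q = maximalIdeal A) (j : ℕ)
    (h : ∀ (N : Type u) [AddCommGroup N] [Module A N] [Module.Finite A N], ∃ c : ℕ, ∀ e,
      (p ^ e : ℕ) * Module.length A ((K.map (iterateFrobenius A p e)).Homology N (i + 1)) ≤
        (c * (p ^ e) ^ j : ℕ))
    (N : Type u) [AddCommGroup N] [Module A N] [Module.Finite A N] :
    ∃ c : ℕ, ∀ e,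
      Module.length A ((K.map (iterateFrobenius A p e)).Homology N i) ≤ (c * (p ^ e) ^ j : ℕ) := by
  refine exists_length_homology_le_of_quotient_prime (fun e ↦ K.map (iterateFrobenius A p e))
    (fun e ↦ (p ^ e) ^ j) i (fun q ↦ ?_) N
  by_cases hq : q.asIdeal = maximalIdeal A
  · have : IsSimpleModule A (A ⧸ q.asIdeal) :=
      isSimpleModule_iff_isCoatom.mpr (hq ▸ (maximalIdeal.isMaximal A).out)
    refine ⟨Fintype.card (K.ι (i + 1)), fun e ↦ Homology.length_le_card_mul.trans ?_⟩
    rw [Module.length_eq_one, mul_one, Nat.cast_le]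
    exact Nat.le_mul_of_pos_right _ (pow_pos (pow_pos (expChar_pos A p) e) j)
  · obtain ⟨x, hxI, hxq⟩ : ∃ x ∈ I, x ∉ q.asIdeal := by
      by_contra! hI'
      exact hq (hIm _ q.2 hI')
    have hx : IsSMulRegular (A ⧸ q.asIdeal) x := isSMulRegular_quotient_of_notMem hxq
    obtain ⟨c, hc⟩ := h (QuotSMulTop x (A ⧸ q.asIdeal))
    exact ⟨c, fun e ↦ (length_homology_frobenius_le p hx (hI x hxI) e).trans (hc e)⟩

theorem exists_length_homology_frobenius_le [IsNoetherianRing A] [IsLocalRing A] (p : ℕ)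
    [ExpChar A p] {K : MatrixComplex A} {g : ℕ} (hg : ∀ i, g < i → K.IsNullAt 1 i) {I : Set A}
    (hI : ∀ x ∈ I, ∀ i, K.IsNullAt x i)
    (hIm : ∀ q : Ideal A, q.IsPrime → I ⊆ q → q = IsLocalRing.maximalIdeal A) (j : ℕ) {i : ℕ}
    (hij : g ≤ i + j) (N : Type u) [AddCommGroup N] [Module A N] [Module.Finite A N] :
    ∃ c : ℕ, ∀ e,
      Module.length A ((K.map (iterateFrobenius A p e)).Homology N i) ≤ (c * (p ^ e) ^ j : ℕ) := by
  -- Each step down in homological degree costs a factor `p ^ e`; above degree `g` nothing is left.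
  induction j generalizing i N with
  | zero =>
    refine exists_length_homology_frobenius_le_of_succ p (fun x hx ↦ hI x hx i) hIm 0
      (fun M _ _ _ ↦ ⟨0, fun e ↦ ?_⟩) N
    have hnull : (K.map (iterateFrobenius A p e)).IsNullAt 1 (i + 1) := by
      simpa using (hg (i + 1) (by omega)).map (iterateFrobenius A p e)
    simp [Homology.length_eq_zero_iff_exactAt.mpr (hnull.exactAt (N := M))]
  | succ j ih =>
    refine exists_length_homology_frobenius_le_of_succ p (fun x hx ↦ hI x hx i) hIm (j + 1)
      (fun M _ _ _ ↦ ?_) N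
    obtain ⟨c, hc⟩ := ih (i := i + 1) (by omega) M
    refine ⟨c, fun e ↦ ?_⟩
    rw [pow_succ', mul_left_comm, Nat.cast_mul]
    exact mul_le_mul_right (hc e) _

end Growth

section Coker

open CategoryTheory

variable (K) in
/-- The cokernel of the differential `R^{ι (i + 1)} → R^{ι i}`. -/
abbrev Coker (i : ℕ) : Type u :=
  (K.ι i → R) ⧸ LinearMap.range (K.diff R i)

lemma isNullAt_one_of_mul_mul_eq (hK : K.ExactAt R i) {s : Matrix (K.ι (i + 1)) (K.ι i) R}
    (hs : K.d i * s * K.d i = K.d i) : K.IsNullAt 1 i := by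
  obtain ⟨t, ht⟩ := exists_mul_eq_of_exact hK (1 - s * K.d i) (by
    rw [Matrix.mul_sub, Matrix.mul_one, ← Matrix.mul_assoc, hs, sub_self])
  exact ⟨s, t, by rw [ht, sub_add_cancel, one_smul]⟩

lemma IsNullAt.exists_mul_mul_eq (h : K.IsNullAt 1 i) :
    ∃ s : Matrix (K.ι (i + 1)) (K.ι i) R, K.d i * s * K.d i = K.d i := by
  obtain ⟨s, t, h⟩ := h
  refine ⟨s, ?_⟩
  rw [Matrix.mul_assoc, eq_sub_of_add_eq' h, Matrix.mul_sub, ← Matrix.mul_assoc, K.d_mul_d,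
    one_smul, Matrix.mul_one, Matrix.zero_mul, sub_zero]

lemma exists_mul_mul_eq_of_projective [Module.Projective R (K.Coker i)] :
    ∃ s : Matrix (K.ι (i + 1)) (K.ι i) R, K.d i * s * K.d i = K.d i := by
  let π := (LinearMap.range (K.diff R i)).mkQ
  obtain ⟨σ, hσ⟩ := Module.projective_lifting_property π LinearMap.id (Submodule.mkQ_surjective _)
  let X : Matrix (K.ι i) (K.ι i) R := LinearMap.toMatrix' (σ ∘ₗ π)
  have hX (v : K.ι i → R) : X.mulVec v = σ (π v) := by
    rw [← Matrix.toLin'_apply, Matrix.toLin'_toMatrix', LinearMap.comp_apply]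
  have hXd : X * K.d i = 0 := Matrix.mulVec_injective <| funext fun v ↦ by
    have hv : π (K.diff R i v) = 0 := (Submodule.Quotient.mk_eq_zero _).mpr ⟨v, rfl⟩
    rw [← Matrix.mulVec_mulVec, hX, Matrix.zero_mulVec]
    exact (congrArg σ hv).trans (map_zero σ)
  obtain ⟨s, hs⟩ := exists_mul_eq_of_forall_mem_range (K.d i) (1 - X) fun j ↦ by
    have hcol : (1 - X).col j = Pi.single j 1 - σ (π (Pi.single j 1)) := by
      rw [← hX, ← Matrix.mulVec_single_one, Matrix.sub_mulVec, Matrix.one_mulVec]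
    rw [← Submodule.Quotient.mk_eq_zero, hcol, Submodule.Quotient.mk_sub, sub_eq_zero]
    exact (LinearMap.congr_fun hσ (π _)).symm
  exact ⟨s, by rw [hs, Matrix.sub_mul, Matrix.one_mul, hXd, sub_zero]⟩

lemma projective_coker_of_mul_mul_eq {s : Matrix (K.ι (i + 1)) (K.ι i) R}
    (hs : K.d i * s * K.d i = K.d i) : Module.Projective R (K.Coker i) := by
  let σ : K.Coker i →ₗ[R] (K.ι i → R) :=
    (LinearMap.range (K.diff R i)).liftQ (LinearMap.id - smulVecLin R (K.d i * s)) (by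
      rintro _ ⟨v, rfl⟩
      rw [LinearMap.mem_ker, LinearMap.sub_apply, LinearMap.id_apply, ← smulVecLin_mul, hs,
        sub_self])
  refine Module.Projective.of_split σ (LinearMap.range (K.diff R i)).mkQ ?_
  refine Submodule.linearMap_qext _ (LinearMap.ext fun v ↦ ?_)
  refine (Submodule.Quotient.eq _).mpr ⟨-smulVecLin R s v, ?_⟩
  change _ = v - smulVecLin R (K.d i * s) v - v
  rw [map_neg, smulVecLin_mul, sub_sub_cancel_left]

lemma projective_coker_iff (hK : K.ExactAt R i) :
    Module.Projective R (K.Coker i) ↔ K.IsNullAt 1 i :=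
  ⟨fun _ ↦ (exists_mul_mul_eq_of_projective).elim fun _ ↦ isNullAt_one_of_mul_mul_eq hK,
    fun h ↦ h.exists_mul_mul_eq.elim fun _ ↦ projective_coker_of_mul_mul_eq⟩

lemma hasProjectiveDimensionLT_coker_succ_iff (hK : K.ExactAt R i) (n : ℕ) :
    HasProjectiveDimensionLT (ModuleCat.of R (K.Coker i)) (n + 2) ↔
      HasProjectiveDimensionLT (ModuleCat.of R (K.Coker (i + 1))) (n + 1) := by
  let f : K.Coker (i + 1) →ₗ[R] (K.ι i → R) :=
    (LinearMap.range (K.diff R (i + 1))).liftQ (K.diff R i) hK.linearMap_ker_eq.ge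
  have hf : LinearMap.range f = LinearMap.range (K.diff R i) := Submodule.range_liftQ _ _ _
  have hexact : Function.Exact f (LinearMap.range (K.diff R i)).mkQ :=
    LinearMap.exact_iff.mpr (by rw [Submodule.ker_mkQ, hf])
  let S : ShortComplex (ModuleCat.{u} R) :=
    ShortComplex.mk (ModuleCat.ofHom f) (ModuleCat.ofHom (LinearMap.range (K.diff R i)).mkQ)
      (ModuleCat.hom_ext hexact.linearMap_comp_eq_zero)
  have hS : S.ShortExact :=
    { exact := (ShortComplex.ShortExact.moduleCat_exact_iff_function_exact S).mpr hexact
      mono_f := (ModuleCat.mono_iff_injective _).mpr <| LinearMap.ker_eq_bot.mp <|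
        Submodule.ker_liftQ_eq_bot _ _ _ hK.linearMap_ker_eq.le
      epi_g := (ModuleCat.epi_iff_surjective _).mpr (Submodule.mkQ_surjective _) }
  have hP : Projective S.X₂ := by
    change Projective (ModuleCat.of R (K.ι i → R))
    rw [← IsProjective.iff_projective]
    infer_instance
  exact hS.hasProjectiveDimensionLT_X₃_iff n hP

lemma hasProjectiveDimensionLT_coker_iff (hK : ∀ j, i ≤ j → K.ExactAt R j) (n : ℕ) :
    HasProjectiveDimensionLT (ModuleCat.of R (K.Coker i)) (n + 1) ↔ K.IsNullAt 1 (i + n) := by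
  induction n generalizing i with
  | zero =>
    rw [zero_add, ← projective_iff_hasProjectiveDimensionLT_one, ← IsProjective.iff_projective]
    exact projective_coker_iff (hK i le_rfl)
  | succ n ih =>
    rw [hasProjectiveDimensionLT_coker_succ_iff (hK i le_rfl),
      ih fun j hj ↦ hK j (Nat.le_of_succ_le hj), Nat.succ_add_eq_add_succ]

end Coker
end MatrixComplex

section CyclicResolution

open CategoryTheory MatrixComplex

variable {R : Type u} [CommRing R]

/-- A resolution of the cyclic module `R ⧸ a` by finite free modules. In accordance with the
indexing of `MatrixComplex`, the module `R = R^{ι 1}` sits in degree `0` and is followed by the zero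
differential, so that `R ⧸ a` is both the cokernel of `d 1` and the homology in degree `0`. -/
structure CyclicResolution (a : Ideal R) extends MatrixComplex R where
  [unique : Unique (ι 1)]
  d_zero : d 0 = 0
  exactAt (i : ℕ) (hi : 1 ≤ i) : toMatrixComplex.ExactAt R i
  span_eq : Ideal.span (Set.range (d 1 default)) = a

lemma exists_exact_smulVecLin [IsNoetherianRing R] {m n : ℕ} (A : Matrix (Fin m) (Fin n) R) :
    ∃ (k : ℕ) (B : Matrix (Fin n) (Fin k) R),
      Function.Exact (smulVecLin R B) (smulVecLin R A) := by
  obtain ⟨k, s, hs⟩ := Submodule.fg_iff_exists_fin_generating_family.mp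
    (IsNoetherian.noetherian (LinearMap.ker (smulVecLin R A)))
  refine ⟨k, .of fun i j ↦ s j i, ?_⟩
  rw [LinearMap.exact_iff, ← hs]
  ext v
  rw [Submodule.mem_span_range_iff_exists_fun]
  refine exists_congr fun c ↦ ?_
  rw [funext_iff, funext_iff]
  simp [smulVecLin_apply, mul_comm]

theorem nonempty_cyclicResolution [IsNoetherianRing R] (a : Ideal R) :
    Nonempty (CyclicResolution a) := by
  obtain ⟨k, s, hs⟩ := Submodule.fg_iff_exists_fin_generating_family.mp
    (IsNoetherian.noetherian a)
  choose next B hB using fun x : Σ m n : ℕ, Matrix (Fin m) (Fin n) R ↦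
    exists_exact_smulVecLin x.2.2
  let x (i : ℕ) : Σ m n : ℕ, Matrix (Fin m) (Fin n) R :=
    Nat.rec ⟨1, k, .of fun _ j ↦ s j⟩ (fun _ x ↦ ⟨x.2.1, next x, B x⟩) i
  let r : ℕ → ℕ
    | 0 => 0
    | i + 1 => (x i).1
  let d : ∀ i, Matrix (Fin (r i)) (Fin (r (i + 1))) R
    | 0 => 0
    | i + 1 => (x i).2.2
  have hd (i : ℕ) : Function.Exact (smulVecLin R (d (i + 2))) (smulVecLin R (d (i + 1))) :=
    hB (x i)
  exact ⟨{
    ι i := Fin (r i)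
    d := d
    d_mul_d
      | 0 => Matrix.zero_mul _
      | i + 1 => mul_eq_zero_of_exact (hd i)
    unique := inferInstanceAs (Unique (Fin 1))
    d_zero := rfl
    exactAt
      | i + 1, _ => hd i
    span_eq := hs }⟩

namespace CyclicResolution

attribute [instance] unique

variable {a : Ideal R} (K : CyclicResolution a)

lemma mem_range_diff_one_iff (v : K.ι 1 → R) :
    v ∈ LinearMap.range (K.diff R 1) ↔ v default ∈ a := by
  refine .trans ?_ (K.span_eq ▸ Ideal.mem_span_range_iff_exists_fun).symm
  refine exists_congr fun w ↦ ?_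
  rw [funext_iff, Unique.forall_iff, smulVecLin_apply]
  simp only [smul_eq_mul, mul_comm]

/-- The augmentation of a resolution of `R ⧸ a`, as an isomorphism. -/
noncomputable def cokerEquiv : K.Coker 1 ≃ₗ[R] R ⧸ a :=
  Submodule.Quotient.equiv _ _ (LinearEquiv.funUnique (K.ι 1) R R) <| by
    ext x
    rw [Submodule.mem_map_equiv, K.mem_range_diff_one_iff]
    rfl

lemma isNullAt {x : R} (hx : x ∈ a) (i : ℕ) : K.IsNullAt x i := by
  induction i with
  | zero =>
    obtain ⟨t, ht⟩ := exists_mul_eq_of_forall_mem_range (K.d 1)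
      (x • (1 : Matrix (K.ι 1) (K.ι 1) R)) fun j ↦
        (K.mem_range_diff_one_iff _).mpr (a.mul_mem_right _ hx)
    exact ⟨0, t, by rw [ht, Matrix.zero_mul, add_zero]⟩
  | succ i ih => exact ih.succ (K.exactAt (i + 1) i.succ_pos)

lemma hasProjectiveDimensionLT_iff (n : ℕ) :
    HasProjectiveDimensionLT (ModuleCat.of R (R ⧸ a)) (n + 1) ↔ K.IsNullAt 1 (1 + n) := by
  rw [← hasProjectiveDimensionLT_coker_iff K.exactAt]
  exact ⟨fun _ ↦ hasProjectiveDimensionLT_of_iso K.cokerEquiv.symm.toModuleIso _,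
    fun _ ↦ hasProjectiveDimensionLT_of_iso K.cokerEquiv.toModuleIso _⟩

lemma isNullAt_one {n : ℕ} (hn : HasProjectiveDimensionLT (ModuleCat.of R (R ⧸ a)) (n + 1))
    (i : ℕ) (hi : n < i) : K.IsNullAt 1 i := by
  induction i, hi using Nat.le_induction with
  | base => simpa only [Nat.add_comm 1] using (K.hasProjectiveDimensionLT_iff n).mp hn
  | succ i _ ih => exact ih.succ (K.exactAt (i + 1) i.succ_pos)

/-- The base change of a resolution along a ring homomorphism with respect to which it stays
acyclic. -/
def baseChange {S : Type v} [CommRing S] (φ : R →+* S)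
    (hexact : ∀ i, 1 ≤ i → (K.map φ).ExactAt S i) : CyclicResolution (a.map φ) where
  toMatrixComplex := K.map φ
  unique := K.unique
  d_zero := by
    change (K.d 0).map φ = 0
    rw [K.d_zero, Matrix.map_zero _ (map_zero φ)]
  exactAt := hexact
  span_eq := by
    conv_rhs => rw [← K.span_eq, Ideal.map_span, ← Set.range_comp]
    rfl

end CyclicResolution

theorem hasProjectiveDimensionLT_quotient_map [IsNoetherianRing R] {S : Type v} [CommRing S]
    (φ : R →+* S) {a : Ideal R} {rs : List R} (hrs : ∀ x ∈ rs, x ∈ a)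
    (hreg : RingTheory.Sequence.IsWeaklyRegular S (rs.map φ))
    (hpd : HasProjectiveDimensionLT (ModuleCat.of R (R ⧸ a)) (rs.length + 1)) :
    HasProjectiveDimensionLT (ModuleCat.of S (S ⧸ a.map φ)) (rs.length + 1) := by
  obtain ⟨K⟩ := nonempty_cyclicResolution a
  have hexact (i : ℕ) (hi : 1 ≤ i) : (K.map φ).ExactAt S i :=
    exactAt_of_isWeaklyRegular (g := rs.length)
      (fun i hi ↦ by simpa only [map_one] using (K.isNullAt_one hpd i hi).map φ)
      (rs := rs.map φ)
      (fun y hy i ↦ by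
        obtain ⟨x, hx, rfl⟩ := List.mem_map.mp hy
        exact (K.isNullAt (hrs x hx) i).map φ)
      hreg (by rw [List.length_map]; lia)
  have hnull : (K.map φ).IsNullAt 1 (1 + rs.length) := by
    simpa only [map_one] using ((K.hasProjectiveDimensionLT_iff _).mp hpd).map φ
  exact ((K.baseChange φ hexact).hasProjectiveDimensionLT_iff _).mpr hnull

theorem hasProjectiveDimensionLT_quotient_map_iterateFrobenius [IsNoetherianRing R] (p : ℕ)
    [ExpChar R p] (e : ℕ) {a : Ideal R} {rs : List R} (hrs : ∀ x ∈ rs, x ∈ a)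
    (hreg : RingTheory.Sequence.IsWeaklyRegular R rs)
    (hpd : HasProjectiveDimensionLT (ModuleCat.of R (R ⧸ a)) (rs.length + 1)) :
    HasProjectiveDimensionLT (ModuleCat.of R (R ⧸ a.map (iterateFrobenius R p e)))
      (rs.length + 1) :=
  hasProjectiveDimensionLT_quotient_map _ hrs (isWeaklyRegular_map_pow hreg (p ^ e)) hpd

end CyclicResolution

section Dimension

open IsLocalRing

variable {A : Type u} [CommRing A]

/-- The Samuel function `n ↦ ℓ(M ⧸ IⁿM)` of a module `M` with respect to an ideal `I`. -/
noncomputable def samuelFunction (I : Ideal A) (M : Type v) [AddCommGroup M] [Module A M] (n : ℕ) :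
    ℕ∞ :=
  Module.length A (M ⧸ (I ^ n • ⊤ : Submodule A M))

lemma samuelFunction_mono (I : Ideal A) (M : Type v) [AddCommGroup M] [Module A M] :
    Monotone (samuelFunction I M) := fun _ _ h ↦
  have h : (I ^ _ • ⊤ : Submodule A M) ≤ I ^ _ • ⊤ :=
    Submodule.smul_mono_left (Ideal.pow_le_pow_right h)
  Module.length_le_of_surjective (Submodule.factor h) (Submodule.factor_surjective h)

lemma samuelFunction_zero (I : Ideal A) (M : Type v) [AddCommGroup M] [Module A M] :
    samuelFunction I M 0 = 0 := by
  rw [samuelFunction, Module.length_eq_zero_iff, pow_zero, Ideal.one_eq_top, Submodule.top_smul]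
  infer_instance

lemma samuelFunction_quotient_le (I q : Ideal A) (n : ℕ) :
    samuelFunction I (A ⧸ q) n ≤ Module.length A (A ⧸ I ^ n) := by
  refine length_le_of_ker_le ((I ^ n • ⊤ : Submodule A (A ⧸ q)).mkQ ∘ₗ q.mkQ) (I ^ n).mkQ
    ((Submodule.mkQ_surjective _).comp (Submodule.mkQ_surjective _)) fun x hx ↦ ?_
  rw [Submodule.ker_mkQ] at hx
  refine (Submodule.Quotient.mk_eq_zero _).mpr ?_
  have hx1 : q.mkQ x = x • q.mkQ 1 := by rw [← map_smul, smul_eq_mul, mul_one]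
  exact hx1 ▸ Submodule.smul_mem_smul hx trivial

variable {M : Type v} [AddCommGroup M] [Module A M]

lemma exists_comap_pow_smul_top_le [IsNoetherianRing A] [Module.Finite A M] {M' : Type*}
    [AddCommGroup M'] [Module A M'] (I : Ideal A) (f : M' →ₗ[A] M) (hf : Function.Injective f) :
    ∃ k, ∀ n, (I ^ (n + k) • ⊤ : Submodule A M).comap f ≤ I ^ n • ⊤ := by
  obtain ⟨k, hk⟩ := I.exists_pow_inf_eq_pow_smul (LinearMap.range f)
  refine ⟨k, fun n ↦ ?_⟩
  have h : (I ^ (n + k) • ⊤ : Submodule A M) ⊓ LinearMap.range f ≤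
      (I ^ n • (⊤ : Submodule A M')).map f := by
    rw [hk (n + k) le_add_self, Nat.add_sub_cancel, Submodule.map_smul'', Submodule.map_top]
    exact Submodule.smul_mono le_rfl inf_le_right
  rw [← Submodule.comap_map_eq_of_injective hf (I ^ n • ⊤)]
  exact fun x hx ↦ h ⟨hx, x, rfl⟩

variable {N : Type w} [AddCommGroup N] [Module A N]

lemma exists_samuelFunction_add_le [IsNoetherianRing A] [Module.Finite A M] {M' : Type w'}
    [AddCommGroup M'] [Module A M'] (I : Ideal A) {f : M' →ₗ[A] M} (hf : Function.Injective f)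
    {g : M →ₗ[A] N} (hg : Function.Surjective g) (hgf : g ∘ₗ f = 0) :
    ∃ k, ∀ n, samuelFunction I M' n + samuelFunction I N (n + k) ≤ samuelFunction I M (n + k) := by
  obtain ⟨k, hk⟩ := exists_comap_pow_smul_top_le I f hf
  refine ⟨k, fun n ↦ ?_⟩
  let π : M →ₗ[A] M ⧸ (I ^ (n + k) • ⊤ : Submodule A M) := Submodule.mkQ _
  have hsub : samuelFunction I M' n ≤ Module.length A (LinearMap.range (π ∘ₗ f)) :=
    length_le_of_ker_le (Submodule.mkQ _) (π ∘ₗ f).rangeRestrict (Submodule.mkQ_surjective _) <| by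
      rw [LinearMap.ker_rangeRestrict, LinearMap.ker_comp, Submodule.ker_mkQ, Submodule.ker_mkQ]
      exact hk n
  have hquot : samuelFunction I N (n + k) ≤ Module.length A (_ ⧸ LinearMap.range (π ∘ₗ f)) := by
    refine length_le_of_ker_le (Submodule.mkQ _ ∘ₗ g) ((LinearMap.range (π ∘ₗ f)).mkQ ∘ₗ π)
      ((Submodule.mkQ_surjective _).comp hg) fun x hx ↦ ?_
    obtain ⟨y, hy⟩ := (Submodule.Quotient.mk_eq_zero _).mp hx
    have hxy : f y - x ∈ (I ^ (n + k) • ⊤ : Submodule A M) := (Submodule.Quotient.eq _).mp hy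
    have hgx : g x = -g (f y - x) := by
      rw [map_sub, ← LinearMap.comp_apply, hgf, LinearMap.zero_apply, zero_sub, neg_neg]
    refine (Submodule.Quotient.mk_eq_zero _).mpr (hgx ▸ neg_mem ?_)
    have hmap := Submodule.mem_map_of_mem (f := g) hxy
    rw [Submodule.map_smul''] at hmap
    exact Submodule.smul_mono le_rfl le_top hmap
  calc samuelFunction I M' n + samuelFunction I N (n + k)
      ≤ Module.length A (LinearMap.range (π ∘ₗ f)) +
          Module.length A (_ ⧸ LinearMap.range (π ∘ₗ f)) := add_le_add hsub hquot
    _ = samuelFunction I M (n + k) :=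
        (Module.length_eq_add_of_exact _ _ (Submodule.subtype_injective _)
          (Submodule.mkQ_surjective _) (LinearMap.exact_subtype_mkQ _)).symm

lemma exists_mul_samuelFunction_le [IsNoetherianRing A] [Module.Finite A M] (I : Ideal A)
    {f : M →ₗ[A] M} (hf : Function.Injective f) {g : M →ₗ[A] N} (hg : Function.Surjective g)
    (hgf : g ∘ₗ f = 0) :
    ∃ k : ℕ, ∀ n t : ℕ, t * samuelFunction I N n ≤ samuelFunction I M (n + t * k) := by
  obtain ⟨k, hk⟩ := exists_samuelFunction_add_le I hf hg hgf
  refine ⟨k, fun n t ↦ ?_⟩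
  induction t with
  | zero => simp
  | succ t ih =>
    calc ((t + 1 : ℕ) : ℕ∞) * samuelFunction I N n
        = t * samuelFunction I N n + samuelFunction I N n := by push_cast; ring
      _ ≤ samuelFunction I M (n + t * k) + samuelFunction I N (n + t * k + k) := by
          gcongr
          exact samuelFunction_mono I N (by lia)
      _ ≤ samuelFunction I M (n + (t + 1) * k) := by
          rw [Nat.succ_mul, ← add_assoc]
          exact hk _

lemma exists_mul_samuelFunction_quotient_le [IsNoetherianRing A] (I : Ideal A) {q q' : Ideal A}
    [q.IsPrime] (h : q < q') :
    ∃ k : ℕ, ∀ n t : ℕ,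
      t * samuelFunction I (A ⧸ q') n ≤ samuelFunction I (A ⧸ q) (n + t * k) := by
  obtain ⟨x, hxq', hxq⟩ := Set.exists_of_ssubset h
  refine exists_mul_samuelFunction_le I (f := LinearMap.lsmul A (A ⧸ q) x)
    (isSMulRegular_quotient_of_notMem hxq) (Submodule.factor_surjective h.le) ?_
  refine Submodule.linearMap_qext _ (LinearMap.ext fun y ↦ ?_)
  exact (Submodule.Quotient.mk_eq_zero q').mpr (q'.mul_mem_right y hxq')

variable [IsLocalRing A]

lemma samuelFunction_one_pos {q : Ideal A} (hq : q ≠ ⊤) :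
    0 < samuelFunction (maximalIdeal A) (A ⧸ q) 1 := by
  have := Ideal.Quotient.nontrivial_iff.mpr hq
  rw [samuelFunction, pow_one, Module.length_pos_iff, Submodule.Quotient.nontrivial_iff]
  exact (Submodule.top_ne_ideal_smul_of_le_jacobson_annihilator (maximalIdeal_le_jacobson _)).symm

variable [IsNoetherianRing A]

theorem coheight_le_of_samuelFunction_le (g c : ℕ) (q : PrimeSpectrum A)
    (h : ∀ n : ℕ, samuelFunction (maximalIdeal A) (A ⧸ q.asIdeal) n ≤ (c * n ^ g : ℕ)) :
    Order.coheight q ≤ g := by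
  induction g generalizing q c with
  | zero =>
    rw [Nat.cast_zero, nonpos_iff_eq_zero, Order.coheight_eq_zero, isMax_iff_forall_not_lt]
    intro q' hq'
    obtain ⟨k, hk⟩ := exists_mul_samuelFunction_quotient_le (maximalIdeal A) hq'
    have hc : ((c + 1 : ℕ) : ℕ∞) ≤ (c : ℕ) :=
      calc ((c + 1 : ℕ) : ℕ∞)
          ≤ (c + 1 : ℕ) * samuelFunction (maximalIdeal A) (A ⧸ q'.asIdeal) 1 :=
            le_mul_of_one_le_right' <| Order.one_le_iff_pos.mpr <|
              samuelFunction_one_pos q'.2.ne_top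
        _ ≤ _ := hk 1 (c + 1)
        _ ≤ (c * _ ^ 0 : ℕ) := h _
        _ = c := by rw [pow_zero, mul_one]
    exact c.not_succ_le_self (Nat.cast_le.mp hc)
  | succ g ih =>
    rw [Order.coheight_le_coe_iff]
    intro q' hq'
    obtain ⟨k, hk⟩ := exists_mul_samuelFunction_quotient_le (maximalIdeal A) hq'
    refine lt_of_le_of_lt (ih (c * (1 + k) ^ (g + 1)) q' fun n ↦ ?_)
      (Nat.cast_lt.mpr g.lt_succ_self)
    rcases eq_or_ne n 0 with rfl | hn
    · simp only [samuelFunction_zero, zero_le]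
    refine (ENat.mul_le_mul_left_iff (Nat.cast_ne_zero.mpr hn) (ENat.natCast_ne_top n)).mp ?_
    calc (n : ℕ∞) * samuelFunction (maximalIdeal A) (A ⧸ q'.asIdeal) n
        ≤ _ := hk n n
      _ ≤ (c * (n + n * k) ^ (g + 1) : ℕ) := h _
      _ = n * (c * (1 + k) ^ (g + 1) * n ^ g : ℕ) := by
        rw [← Nat.cast_mul, ← mul_one_add, mul_pow]
        congr 1
        ring

theorem ringKrullDim_le_of_length_le {g c p : ℕ} (hp : 1 < p)
    (h : ∀ e : ℕ, Module.length A (A ⧸ maximalIdeal A ^ p ^ e) ≤ (c * (p ^ e) ^ g : ℕ)) :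
    ringKrullDim A ≤ g := by
  rw [ringKrullDim, Order.krullDim_eq_iSup_coheight, iSup_le_iff]
  refine fun q ↦ WithBot.coe_le_coe.mpr <|
    coheight_le_of_samuelFunction_le g (c * p ^ g) q fun n ↦ ?_
  rcases eq_or_ne n 0 with rfl | hn
  · simp only [samuelFunction_zero, zero_le]
  calc samuelFunction (maximalIdeal A) (A ⧸ q.asIdeal) n
      ≤ samuelFunction (maximalIdeal A) (A ⧸ q.asIdeal) (p ^ (Nat.log p n + 1)) :=
        samuelFunction_mono _ _ (Nat.lt_pow_succ_log_self hp n).le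
    _ ≤ Module.length A (A ⧸ maximalIdeal A ^ p ^ (Nat.log p n + 1)) :=
        samuelFunction_quotient_le _ _ _
    _ ≤ (c * (p ^ (Nat.log p n + 1)) ^ g : ℕ) := h _
    _ ≤ (c * p ^ g * n ^ g : ℕ) := by
        rw [mul_assoc, ← mul_pow, pow_succ']
        gcongr
        exact Nat.pow_log_le_self p hn

end Dimension

section NewIntersection

open IsLocalRing MatrixComplex

lemma length_quotient_le_length_homology_zero {A : Type u} [CommRing A] {K : MatrixComplex A}
    (hd : K.d 0 = 0) (z : K.ι 1) {I : Ideal A} (hz : ∀ j, K.d 1 z j ∈ I) :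
    Module.length A (A ⧸ I) ≤ Module.length A (K.Homology A 0) := by
  refine length_le_of_ker_le (I.mkQ ∘ₗ LinearMap.proj z ∘ₗ Submodule.subtype _)
    (Submodule.mkQ _ : LinearMap.ker (K.diff A 0) →ₗ[A] K.Homology A 0) (fun y ↦ ?_) fun v hv ↦ ?_
  · obtain ⟨y, rfl⟩ := I.mkQ_surjective y
    exact ⟨⟨Function.const _ y, by rw [LinearMap.mem_ker, diff, hd, smulVecLin_zero]⟩, rfl⟩
  · rw [Submodule.ker_mkQ] at hv
    obtain ⟨w, hw⟩ := hv
    have hvz : v.1 z = ∑ j, K.d 1 z j • w j := (congrFun hw z).symm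
    refine (Submodule.Quotient.mk_eq_zero I).mpr (?_ : v.1 z ∈ I)
    exact hvz ▸ I.sum_mem fun j _ ↦ I.mul_mem_right (w j) (hz j)

theorem ringKrullDim_le_of_isNullAt {A : Type u} [CommRing A] [IsNoetherianRing A]
    [IsLocalRing A] (p : ℕ) [Fact p.Prime] [CharP A p] {K : MatrixComplex A} (hd : K.d 0 = 0)
    (z : K.ι 1) (hz : ∀ j, K.d 1 z j ∈ maximalIdeal A) {g : ℕ}
    (hg : ∀ i, g < i → K.IsNullAt 1 i) {I : Set A} (hI : ∀ x ∈ I, ∀ i, K.IsNullAt x i)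
    (hIm : ∀ q : Ideal A, q.IsPrime → I ⊆ q → q = maximalIdeal A) :
    ringKrullDim A ≤ g := by
  obtain ⟨c, hc⟩ := exists_length_homology_frobenius_le p hg hI hIm g (zero_add g).ge A
  refine ringKrullDim_le_of_length_le (c := c) (Fact.out : p.Prime).one_lt fun e ↦
    (length_quotient_le_length_homology_zero (K := K.map (iterateFrobenius A p e)) ?_ z
      fun j ↦ ?_).trans (hc e)
  · change (K.d 0).map (iterateFrobenius A p e) = 0
    rw [hd, Matrix.map_zero _ (map_zero _)]
  · exact Ideal.pow_mem_pow (hz j) (p ^ e)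

theorem height_le_of_mem_minimalPrimes_of_hasProjectiveDimensionLT {R : Type u} [CommRing R]
    [IsNoetherianRing R] (p : ℕ) [Fact p.Prime] [CharP R p] {a P : Ideal R}
    (hP : P ∈ a.minimalPrimes) {g : ℕ}
    (hg : CategoryTheory.HasProjectiveDimensionLT (ModuleCat.of R (R ⧸ a)) (g + 1)) :
    P.height ≤ g := by
  have hPp : P.IsPrime := hP.1.1
  obtain ⟨K⟩ := nonempty_cyclicResolution a
  let A := Localization.AtPrime P
  let φ := algebraMap R A
  have : CharP A p := (CharP.charP_iff_prime_eq_zero Fact.out).mpr <| by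
    rw [← map_natCast φ, CharP.cast_eq_zero, map_zero]
  suffices ringKrullDim A ≤ g by
    rw [IsLocalization.AtPrime.ringKrullDim_eq_height P A] at this
    exact WithBot.coe_le_coe.mp this
  refine ringKrullDim_le_of_isNullAt p (K := K.map φ) ?_ (default : K.ι 1) (fun j ↦ ?_)
    (fun i hi ↦ ?_) (I := φ '' a) ?_ fun q hq haq ↦ ?_
  · change (K.d 0).map φ = 0
    rw [K.d_zero, Matrix.map_zero _ (map_zero _)]
  · refine (IsLocalization.AtPrime.to_map_mem_maximal_iff A P _).mpr (hP.1.2 ?_)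
    exact K.span_eq.le (Ideal.subset_span ⟨j, rfl⟩)
  · simpa only [map_one] using (K.isNullAt_one hg i hi).map φ
  · rintro _ ⟨x, hx, rfl⟩ i
    exact (K.isNullAt hx i).map φ
  · have hqP : q.under R ≤ P :=
      (Ideal.comap_mono (le_maximalIdeal hq.ne_top)).trans
        Localization.AtPrime.under_maximalIdeal.le
    exact Localization.AtPrime.eq_maximalIdeal_iff_under_eq.mp <|
      le_antisymm hqP (hP.2 ⟨hq.under R, fun x hx ↦ haq ⟨x, hx, rfl⟩⟩ hqP)

open RingTheory.Sequence in
lemma length_le_height_of_isWeaklyRegular {R : Type u} [CommRing R] [IsNoetherianRing R]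
    {P : Ideal R} [P.IsPrime] {rs : List R} (h : IsWeaklyRegular R rs) (hP : ∀ x ∈ rs, x ∈ P) :
    (rs.length : ℕ∞) ≤ P.height := by
  let A := Localization.AtPrime P
  have hA : IsRegular A (rs.map (algebraMap R A)) := h.isRegular_of_isLocalization_of_mem A P hP
  have : Nontrivial (A ⧸ Ideal.ofList (rs.map (algebraMap R A))) :=
    Ideal.Quotient.nontrivial_iff.mpr fun htop ↦ hA.2 (by rw [htop, Submodule.top_smul])
  refine WithBot.coe_le_coe.mp ?_
  rw [← IsLocalization.AtPrime.ringKrullDim_eq_height P A,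
    ← ringKrullDim_add_length_eq_ringKrullDim_of_isRegular _ hA, List.length_map]
  exact le_add_of_nonneg_left ringKrullDim_nonneg_of_nontrivial

end NewIntersection

open CategoryTheory Limits Opposite

section Ext

open RingTheory.Sequence Abelian

variable {R : Type u} [CommRing R]

lemma isWeaklyRegular_of_flat {rs : List R} (h : IsWeaklyRegular R rs) (M : Type v)
    [AddCommGroup M] [Module R M] [Module.Flat R M] : IsWeaklyRegular M rs :=
  ((TensorProduct.rid R M).isWeaklyRegular_congr rs).mp h.isWeaklyRegular_lTensor

lemma subsingleton_ext_of_isWeaklyRegular (N : ModuleCat.{u} R) {rs : List R}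
    (hN : ∀ x ∈ rs, x ∈ Module.annihilator R N) (M : ModuleCat.{u} R) (hM : IsWeaklyRegular M rs)
    {i : ℕ} (hi : i < rs.length) : Subsingleton (Abelian.Ext N M i) := by
  induction rs generalizing M i with
  | nil => simp at hi
  | cons x rs ih =>
    obtain ⟨hx, hrs⟩ := (isWeaklyRegular_cons_iff _ _ _).mp hM
    have hxN : x ∈ Module.annihilator R N := hN x (by simp)
    rcases i with _ | i
    · have := hx.linearMap_subsingleton_of_mem_annihilator hxN
      exact (Abelian.Ext.addEquiv₀.trans ModuleCat.homAddEquiv).subsingleton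
    · have hS : (M.smulShortComplex x).ShortExact := hx.smulShortComplex_shortExact
      have hquot : Subsingleton (Abelian.Ext N (M.smulShortComplex x).X₃ i) :=
        ih (fun y hy ↦ hN y (by simp [hy])) (ModuleCat.of R (QuotSMulTop x M)) hrs
          (by simpa using hi)
      refine subsingleton_of_forall_eq 0 fun α ↦ ?_
      have hα : α.comp (Abelian.Ext.mk₀ (M.smulShortComplex x).f) (add_zero _) = 0 :=
        congrArg (fun φ ↦ φ.hom α) (Ext.postcomp_smul_id_eq_zero_of_mem_annihilator (M := M)
          hxN (i + 1))
      obtain ⟨β, rfl⟩ := Abelian.Ext.covariant_sequence_exact₁ N hS α hα (n₀ := i) rfl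
      rw [Subsingleton.elim β 0, Abelian.Ext.zero_comp]
      rfl

-- Depth sensitivity: the kernel of `f` has no `Ext` into `M` in degrees below the length of `rs`.
lemma ext_eq_zero_of_mk₀_comp_eq_zero {N N' : ModuleCat.{u} R} (f : N' ⟶ N)
    (hf : Function.Surjective f) {rs : List R} (hN : ∀ x ∈ rs, x ∈ Module.annihilator R N')
    {M : ModuleCat.{u} R} (hM : IsWeaklyRegular M rs) {m : ℕ} (hm : m < rs.length)
    (α : Abelian.Ext N M (m + 1)) (hα : (Abelian.Ext.mk₀ f).comp α (zero_add _) = 0) : α = 0 := by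
  have hS : f.hom.shortComplexKer.ShortExact := LinearMap.shortExact_shortComplexKer hf
  have hker : Subsingleton (Abelian.Ext f.hom.shortComplexKer.X₁ M m) :=
    subsingleton_ext_of_isWeaklyRegular _ (fun x hx ↦
      (LinearMap.ker f.hom).subtype.annihilator_le_of_injective
        (Submodule.injective_subtype _) (hN x hx)) M hM hm
  obtain ⟨β, rfl⟩ := Abelian.Ext.contravariant_sequence_exact₃ hS M α hα (n₀ := m) (add_comm _ _)
  rw [Subsingleton.elim β 0, Abelian.Ext.comp_zero]

lemma exists_free_not_subsingleton_ext {N : ModuleCat.{u} R} {n : ℕ}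
    [HasProjectiveDimensionLT N (n + 1)] (h : ¬ HasProjectiveDimensionLT N n) :
    ∃ M : ModuleCat.{u} R, Module.Free R M ∧ ¬ Subsingleton (Abelian.Ext N M n) := by
  rw [hasProjectiveDimensionLT_iff] at h
  push Not at h
  obtain ⟨i, hi, Y, α, hα⟩ := h
  obtain rfl : i = n := by
    by_contra hne
    exact hα (α.eq_zero_of_hasProjectiveDimensionLT (n + 1) (by omega))
  refine ⟨Y.projectiveShortComplex.X₂, inferInstance, fun hsub ↦ hα ?_⟩
  obtain ⟨β, rfl⟩ := Abelian.Ext.covariant_sequence_exact₃ N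
    Y.shortExact_projectiveShortComplex α rfl
    (Abelian.Ext.eq_zero_of_hasProjectiveDimensionLT _ (i + 1) le_rfl)
  rw [Subsingleton.elim β 0, Abelian.Ext.zero_comp]

end Ext

section DerivedExt

-- `localCohomology` is defined through the functor `Ext R C n`, computed from projective
-- resolutions; the long exact sequences are available for the groups `Abelian.Ext`.

variable {R : Type u} [CommRing R]

lemma epi_of_comp_iso_hom_eq {C : Type v} [Category.{w} C] {X Y X' Y' : C}
    {f : X ⟶ Y} {g : X' ⟶ Y'} {e : X ≅ X'} {e' : Y ≅ Y'} (h : f ≫ e'.hom = e.hom ≫ g) [Epi g] :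
    Epi f := by
  rw [← Iso.eq_comp_inv] at h
  rw [h]
  infer_instance

lemma exists_toCycles_eq_of_homologyπ_eq_zero (L : CochainComplex (ModuleCat.{u} R) ℕ) {m : ℕ}
    {z : L.cycles (m + 1)} (hz : L.homologyπ (m + 1) z = 0) :
    ∃ w : L.X m, L.toCycles m (m + 1) w = z :=
  (ShortComplex.moduleCat_exact_iff _).mp (ShortComplex.exact_of_g_is_cokernel
    (ShortComplex.mk (L.toCycles m (m + 1)) (L.homologyπ (m + 1)) (by simp))
    (L.homologyIsCokernel m (m + 1) (by simp))) z hz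

lemma mono_homologyMap_succ {K L : CochainComplex (ModuleCat.{u} R) ℕ} (φ : K ⟶ L) (m : ℕ)
    (h : ∀ z : K.X (m + 1), K.d (m + 1) (m + 2) z = 0 →
      (∃ w : L.X m, L.d m (m + 1) w = φ.f (m + 1) z) → ∃ w : K.X m, K.d m (m + 1) w = z) :
    Mono (HomologicalComplex.homologyMap φ (m + 1)) := by
  rw [ModuleCat.mono_iff_injective, injective_iff_map_eq_zero]
  intro x hx
  obtain ⟨z, rfl⟩ := (ModuleCat.epi_iff_surjective (K.homologyπ (m + 1))).mp inferInstance x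
  rw [← ConcreteCategory.comp_apply, HomologicalComplex.homologyπ_naturality,
    ConcreteCategory.comp_apply] at hx
  obtain ⟨w, hw⟩ := exists_toCycles_eq_of_homologyπ_eq_zero L hx
  have hcycle : K.d (m + 1) (m + 2) (K.iCycles (m + 1) z) = 0 := by
    rw [← ConcreteCategory.comp_apply, HomologicalComplex.iCycles_d]
    rfl
  have hboundary : L.d m (m + 1) w = φ.f (m + 1) (K.iCycles (m + 1) z) := by
    rw [← L.toCycles_i, ConcreteCategory.comp_apply, hw, ← ConcreteCategory.comp_apply,
      HomologicalComplex.cyclesMap_i, ConcreteCategory.comp_apply]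
  obtain ⟨v, hv⟩ := h _ hcycle ⟨w, hboundary⟩
  have hz : K.toCycles m (m + 1) v = z := by
    apply (ModuleCat.mono_iff_injective (K.iCycles (m + 1))).mp inferInstance
    rw [← ConcreteCategory.comp_apply, HomologicalComplex.toCycles_i, hv]
  rw [← hz, ← ConcreteCategory.comp_apply, HomologicalComplex.toCycles_comp_homologyπ]
  rfl

lemma epi_homologyMap_op_of_mono {ι : Type w} {c : ComplexShape ι}
    {K L : HomologicalComplex (ModuleCat.{u} R) c} (θ : K ⟶ L) (n : ι)
    [Mono (HomologicalComplex.homologyMap θ n)] :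
    Epi (HomologicalComplex.homologyMap
      ((HomologicalComplex.opFunctor (ModuleCat.{u} R) c).map θ.op) n) :=
  have := op_epi_of_mono (HomologicalComplex.homologyMap θ n)
  epi_of_comp_iso_hom_eq (HomologicalComplex.homologyOp_hom_naturality θ n)

variable {X X' : ModuleCat.{u} R} (M : ModuleCat.{u} R)

lemma mono_ext_map_succ (f : X' ⟶ X) (m : ℕ)
    (h : ∀ α : Abelian.Ext X M (m + 1),
      (Abelian.Ext.mk₀ f).comp α (zero_add _) = 0 → α = 0) :
    Mono (((Ext R (ModuleCat.{u} R) (m + 1)).map f.op).app M) := by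
  let P := ProjectiveResolution.of X
  let P' := ProjectiveResolution.of X'
  let φ := ProjectiveResolution.lift f P' P
  have hφ : φ ≫ P.π = P'.π ≫ (ChainComplex.single₀ _).map f := by simp [φ]
  let Φ : ProjectiveResolution.Hom P' P f :=
    ⟨φ, by rw [← HomologicalComplex.comp_f, hφ, HomologicalComplex.comp_f]⟩
  let F := ((linearYoneda R (ModuleCat.{u} R)).obj M).rightOp
  have hepi : Epi (HomologicalComplex.homologyMap ((F.mapHomologicalComplex _).map φ) (m + 1)) := by
    let ψ := (HomologicalComplex.unopFunctor (ModuleCat.{u} R) _).map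
      ((F.mapHomologicalComplex _).map φ).op
    suffices Mono (HomologicalComplex.homologyMap ψ (m + 1)) from
      epi_homologyMap_op_of_mono ψ (m + 1)
    refine mono_homologyMap_succ _ _ ?_
    rintro (z : P.complex.X (m + 1) ⟶ M) (hz : P.complex.d (m + 2) (m + 1) ≫ z = 0)
      ⟨(w : P'.complex.X m ⟶ M), hw⟩
    replace hw : P'.complex.d (m + 1) m ≫ w = φ.f (m + 1) ≫ z := hw
    have hcomp : (Abelian.Ext.mk₀ f).comp (P.extMk z (m + 2) rfl hz) (zero_add _) = 0 :=
      (ProjectiveResolution.mk₀_comp_extMk z (m + 2) rfl hz Φ).trans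
        ((P'.extMk_eq_zero_iff _ _ _ _ m rfl).mpr ⟨w, hw⟩)
    exact (P.extMk_eq_zero_iff _ _ _ _ m rfl).mp (h _ hcomp)
  suffices Epi ((F.leftDerived (m + 1)).map f) from
    inferInstanceAs (Mono ((F.leftDerived (m + 1)).map f).unop)
  rw [F.leftDerived_map_eq (m + 1) f φ hφ]
  exact epi_comp' inferInstance (epi_comp' hepi inferInstance)

lemma isZero_ext_succ_iff (m : ℕ) :
    IsZero (((Ext R (ModuleCat.{u} R) (m + 1)).obj (op X)).obj M) ↔
      Subsingleton (Abelian.Ext X M (m + 1)) := by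
  let P := ProjectiveResolution.of X
  rw [(P.isoExt (R := R) (m + 1) M).isZero_iff,
    ← HomologicalComplex.exactAt_iff_isZero_homology,
    HomologicalComplex.exactAt_iff' _ m (m + 1) (m + 2) (by simp) (by simp),
    ShortComplex.moduleCat_exact_iff]
  constructor
  · intro h
    refine subsingleton_of_forall_eq 0 fun α ↦ ?_
    obtain ⟨z, hz, rfl⟩ := P.extMk_surjective α (m + 2) rfl
    obtain ⟨w, hw⟩ := h z hz
    exact (P.extMk_eq_zero_iff _ _ _ _ m rfl).mpr ⟨w, hw⟩
  · rintro h (z : P.complex.X (m + 1) ⟶ M) (hz : P.complex.d (m + 2) (m + 1) ≫ z = 0)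
    exact (P.extMk_eq_zero_iff z (m + 2) rfl hz m rfl).mp (Subsingleton.elim _ _)

end DerivedExt

open CategoryTheory Limits Opposite RingTheory.Sequence

section LocalCohomology

variable {R : Type u} [CommRing R]

/-- The canonical surjection `R ⧸ I ⟶ R ⧸ J` for `I ≤ J`, as a morphism of `R`-modules. -/
abbrev quotientHom {I J : Ideal R} (h : I ≤ J) :
    ModuleCat.of R (R ⧸ I) ⟶ ModuleCat.of R (R ⧸ J) :=
  ModuleCat.ofHom (Submodule.mapQ I J LinearMap.id h)

lemma quotientHom_comp {I J K : Ideal R} (h : I ≤ J) (h' : J ≤ K) :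
    quotientHom h ≫ quotientHom h' = quotientHom (h.trans h') := by
  ext
  rfl

lemma quotientHom_surjective {I J : Ideal R} (h : I ≤ J) :
    Function.Surjective (quotientHom h) := fun y ↦ by
  obtain ⟨y, rfl⟩ := Submodule.Quotient.mk_surjective _ y
  exact ⟨Submodule.Quotient.mk y, rfl⟩

/-- The directed system of the modules `Ext^i(R ⧸ aⁿ, M)`, whose colimit is the local cohomology
module `H^i_a(M)`. Both variances, of `n ↦ aⁿ` and of `Ext` in its first argument, appear as `ᵒᵖ`
in the index category. -/
noncomputable abbrev extSystem (a : Ideal R) (i : ℕ) (M : ModuleCat.{u} R) :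
    (ℕᵒᵖ)ᵒᵖ ⥤ ModuleCat.{u} R :=
  localCohomology.diagram (localCohomology.idealPowersDiagram a) i ⋙ (evaluation _ _).obj M

/-- The identification of `H^i_a(M)` with the colimit of the modules `Ext^i(R ⧸ aⁿ, M)`; evaluation
at `M` commutes with the colimit of functors defining `localCohomology`. -/
noncomputable def localCohomologyObjIsoColimit (a : Ideal R) (i : ℕ) (M : ModuleCat.{u} R) :
    (localCohomology a i).obj M ≅ colimit (extSystem a i M) :=
  colimitObjIsoColimitCompEvaluation
    (localCohomology.diagram (localCohomology.idealPowersDiagram a) i) M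

lemma ext_map_quotientHom_eq_zero {I J K : Ideal R} (hIJ : I ≤ J) (hJK : J ≤ K) (i : ℕ)
    (M : ModuleCat.{u} R)
    (hJ : IsZero (((Ext R (ModuleCat.{u} R) i).obj (op (ModuleCat.of R (R ⧸ J)))).obj M)) :
    ((Ext R (ModuleCat.{u} R) i).map (quotientHom (hIJ.trans hJK)).op).app M = 0 := by
  rw [← quotientHom_comp hIJ hJK, op_comp, Functor.map_comp, NatTrans.comp_app,
    hJ.eq_zero_of_tgt (((Ext R (ModuleCat.{u} R) i).map (quotientHom hJK).op).app M), zero_comp]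

lemma isZero_localCohomology_of_forall_exists (a : Ideal R) (i : ℕ) (M : ModuleCat.{u} R)
    (h : ∀ n : ℕ, ∃ (b : Ideal R) (k : ℕ), a ^ k ≤ b ∧ b ≤ a ^ n ∧
      IsZero (((Ext R (ModuleCat.{u} R) i).obj (op (ModuleCat.of R (R ⧸ b)))).obj M)) :
    IsZero ((localCohomology a i).obj M) := by
  refine IsZero.of_iso ?_ (localCohomologyObjIsoColimit a i M)
  rw [IsZero.iff_id_eq_zero]
  refine colimit.hom_ext fun j ↦ ?_
  obtain ⟨b, k, hkb, hbn, hb⟩ := h j.unop.unop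
  let t : j ⟶ op (op (max k j.unop.unop)) := (homOfLE (le_max_right _ _)).op.op
  have hle : a ^ max k j.unop.unop ≤ b := (Ideal.pow_le_pow_right (le_max_left _ _)).trans hkb
  have ht : (extSystem a i M).map t = 0 := ext_map_quotientHom_eq_zero hle hbn i M hb
  rw [← colimit.w (extSystem a i M) t, ht]
  simp

lemma not_isZero_localCohomology_of_forall_mono (a : Ideal R) (i : ℕ) (M : ModuleCat.{u} R) (n : ℕ)
    (hn : ¬ IsZero (((Ext R (ModuleCat.{u} R) i).obj (op (ModuleCat.of R (R ⧸ a ^ n)))).obj M))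
    (h : ∀ (k : ℕ) (hk : n ≤ k), Mono (((Ext R (ModuleCat.{u} R) i).map
      (quotientHom (Ideal.pow_le_pow_right (I := a) hk)).op).app M)) :
    ¬ IsZero ((localCohomology a i).obj M) := by
  refine fun hzero ↦ hn ?_
  replace hzero : IsZero (colimit (extSystem a i M)) :=
    IsZero.of_iso hzero (localCohomologyObjIsoColimit a i M).symm
  have : PreservesFilteredColimitsOfSize.{0, 0} (forget (ModuleCat.{u} R)) :=
    preservesFilteredColimitsOfSize_shrink.{0, u, 0, u} _
  have hsub : Subsingleton ((extSystem a i M).obj (op (op n))) := by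
    refine subsingleton_of_forall_eq 0 fun x ↦ ?_
    obtain ⟨j, t, ht⟩ := Concrete.colimit_rep_eq_zero R (extSystem a i M) (op (op n)) x (by
      rw [hzero.eq_zero_of_tgt (colimit.ι (extSystem a i M) (op (op n)))]
      rfl)
    have hmono := h j.unop.unop (leOfHom t.unop.unop)
    exact (ModuleCat.mono_iff_injective _).mp hmono (ht.trans (map_zero _).symm)
  exact @ModuleCat.isZero_of_subsingleton _ _ _ hsub

end LocalCohomology

section PerfectIdeal

variable {R : Type u} [CommRing R] {a : Ideal R} {rs : List R}

lemma exists_pow_le_map_iterateFrobenius (ha : a.FG) (p : ℕ) [ExpChar R p] (e : ℕ) :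
    ∃ k, a ^ k ≤ a.map (iterateFrobenius R p e) :=
  Ideal.exists_pow_le_of_le_radical_of_fg
    (fun _ hx ↦ ⟨p ^ e, Ideal.mem_map_of_mem (iterateFrobenius R p e) hx⟩) ha

lemma map_iterateFrobenius_le_pow (a : Ideal R) (p : ℕ) [Fact p.Prime] [CharP R p] (e : ℕ) :
    a.map (iterateFrobenius R p e) ≤ a ^ e :=
  Ideal.map_le_iff_le_comap.mpr fun _ hx ↦
    Ideal.pow_le_pow_right (Nat.lt_pow_self (Nat.Prime.one_lt Fact.out)).le (Ideal.pow_mem_pow hx _)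

theorem isZero_localCohomology_of_length_lt [IsNoetherianRing R] (p : ℕ) [Fact p.Prime] [CharP R p]
    (hrs : ∀ x ∈ rs, x ∈ a) (hreg : IsWeaklyRegular R rs)
    (hpd : HasProjectiveDimensionLT (ModuleCat.of R (R ⧸ a)) (rs.length + 1))
    (M : ModuleCat.{u} R) {i : ℕ} (hi : rs.length < i) :
    IsZero ((localCohomology a i).obj M) := by
  refine isZero_localCohomology_of_forall_exists a i M fun n ↦ ?_
  obtain ⟨k, hk⟩ := exists_pow_le_map_iterateFrobenius (IsNoetherian.noetherian a) p n
  refine ⟨_, k, hk, map_iterateFrobenius_le_pow a p n, ?_⟩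
  have := hasProjectiveDimensionLT_quotient_map_iterateFrobenius p n hrs hreg hpd
  obtain ⟨m, rfl⟩ := Nat.exists_eq_succ_of_ne_zero (Nat.ne_zero_of_lt hi)
  rw [isZero_ext_succ_iff]
  exact HasProjectiveDimensionLT.subsingleton _ (rs.length + 1) _ hi _

lemma mem_annihilator_quotient_pow {x : R} (hx : x ∈ a) (k : ℕ) :
    x ^ k ∈ Module.annihilator R (R ⧸ a ^ k) :=
  Ideal.annihilator_quotient.ge (Ideal.pow_mem_pow hx k)

lemma mono_ext_map_quotientHom_pow (hrs : ∀ x ∈ rs, x ∈ a) {M : ModuleCat.{u} R}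
    (hM : IsWeaklyRegular M rs) {m : ℕ} (hm : m < rs.length) {n k : ℕ} (hk : n ≤ k) :
    Mono (((Ext R (ModuleCat.{u} R) (m + 1)).map
      (quotientHom (Ideal.pow_le_pow_right (I := a) hk)).op).app M) := by
  have hann : ∀ y ∈ rs.map (· ^ k), y ∈ Module.annihilator R (R ⧸ a ^ k) :=
    List.forall_mem_map.mpr fun x hx ↦ mem_annihilator_quotient_pow (hrs x hx) k
  exact mono_ext_map_succ M _ m fun α ↦ ext_eq_zero_of_mk₀_comp_eq_zero _
    (quotientHom_surjective _) hann (isWeaklyRegular_map_pow hM k) (by simpa using hm) α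

theorem exists_not_isZero_localCohomology_length (hrs : ∀ x ∈ rs, x ∈ a)
    (hreg : IsWeaklyRegular R rs)
    (hpd : projectiveDimension (ModuleCat.of R (R ⧸ a)) = (rs.length : ℕ)) (hpos : rs.length ≠ 0) :
    ∃ M : ModuleCat.{u} R, ¬ IsZero ((localCohomology a rs.length).obj M) := by
  have hpd_le : HasProjectiveDimensionLT (ModuleCat.of R (R ⧸ a)) (rs.length + 1) :=
    (projectiveDimension_le_iff _ _).mp hpd.le
  have hpd_ge : ¬ HasProjectiveDimensionLT (ModuleCat.of R (R ⧸ a)) rs.length := fun h ↦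
    hpd.ge.not_gt (projectiveDimension_lt_iff.mpr h)
  obtain ⟨M, hfree, hM⟩ := exists_free_not_subsingleton_ext hpd_ge
  obtain ⟨m, hm⟩ := Nat.exists_eq_succ_of_ne_zero hpos
  rw [hm] at hM ⊢
  refine ⟨M, not_isZero_localCohomology_of_forall_mono a (m + 1) M 1 ?_ fun k hk ↦
    mono_ext_map_quotientHom_pow hrs (isWeaklyRegular_of_flat hreg M) (by omega) hk⟩
  rwa [isZero_ext_succ_iff, pow_one]

theorem cohomologicalDimension_eq_length_of_isWeaklyRegular [IsNoetherianRing R] (p : ℕ)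
    [Fact p.Prime] [CharP R p] (hrs : ∀ x ∈ rs, x ∈ a) (hreg : IsWeaklyRegular R rs)
    (hpd : projectiveDimension (ModuleCat.of R (R ⧸ a)) = (rs.length : ℕ)) :
    a.cohomologicalDimension = rs.length := by
  refine le_antisymm ?_ (le_iInf₂ fun c hc ↦ ?_)
  · exact iInf₂_le (f := fun (c : ℕ) _ ↦ (c : ℕ∞)) rs.length fun M i hi ↦
      isZero_localCohomology_of_length_lt p hrs hreg ((projectiveDimension_le_iff _ _).mp hpd.le)
        M hi
  · by_contra! hlt
    replace hlt : c < rs.length := by exact_mod_cast hlt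
    obtain ⟨M, hM⟩ := exists_not_isZero_localCohomology_length hrs hreg hpd (by omega)
    exact hM (hc M _ hlt)

theorem height_eq_length_of_isWeaklyRegular [IsNoetherianRing R] (p : ℕ) [Fact p.Prime] [CharP R p]
    (hne : a ≠ ⊤) (hrs : ∀ x ∈ rs, x ∈ a) (hreg : IsWeaklyRegular R rs)
    (hpd : HasProjectiveDimensionLT (ModuleCat.of R (R ⧸ a)) (rs.length + 1)) :
    a.height = rs.length := by
  apply le_antisymm
  · obtain ⟨P, hP⟩ := Ideal.nonempty_minimalPrimes hne
    have := hP.isPrime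
    exact (Ideal.height_mono hP.1.2).trans
      (height_le_of_mem_minimalPrimes_of_hasProjectiveDimensionLT p hP hpd)
  · rw [a.height_eq_inf_minimalPrimes]
    refine le_iInf₂ fun P hP ↦ ?_
    have := hP.isPrime
    exact length_le_height_of_isWeaklyRegular hreg fun x hx ↦ hP.1.2 (hrs x hx)

lemma grade_le_height_of_le [IsNoetherianRing R] {P : Ideal R} [P.IsPrime] (hP : a ≤ P) :
    a.grade ≤ P.height :=
  iSup₂_le fun _ h ↦ length_le_height_of_isWeaklyRegular h.1.toIsWeaklyRegular
    fun x hx ↦ hP (h.2 x hx)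

lemma exists_isRegular_length_eq_grade [IsNoetherianRing R] (hne : a ≠ ⊤) :
    ∃ rs : List R, IsRegular R rs ∧ (∀ x ∈ rs, x ∈ a) ∧ a.grade = rs.length := by
  have hnontrivial : Nontrivial R := (Submodule.nontrivial_iff R).mp ⟨a, ⊤, hne⟩
  obtain ⟨P, hP, haP⟩ := a.exists_le_maximal hne
  have hfin : a.grade < ⊤ :=
    (grade_le_height_of_le haP).trans_lt (Ideal.height_ne_top hP.ne_top).lt_top
  have : Nonempty {rs : List R // IsRegular R rs ∧ ∀ x ∈ rs, x ∈ a} :=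
    ⟨[], .nil R R, by simp⟩
  rw [Ideal.grade, iSup_subtype'] at hfin ⊢
  obtain ⟨⟨rs, hreg, hrs⟩, h⟩ := ENat.exists_eq_iSup_of_lt_top hfin
  exact ⟨rs, hreg, hrs, h.symm⟩

lemma ne_top_of_isPerfect (ha : a.IsPerfect) : a ≠ ⊤ := by
  rintro rfl
  have hsub : Subsingleton (R ⧸ (⊤ : Ideal R)) := Ideal.Quotient.subsingleton_iff.mpr rfl
  have hbot := (projectiveDimension_eq_bot_iff (ModuleCat.of R (R ⧸ (⊤ : Ideal R)))).mpr
    (ModuleCat.isZero_of_subsingleton _)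
  exact WithBot.bot_ne_coe (hbot.symm.trans ha)

end PerfectIdeal

theorem corollary2p2 {R : Type u} [CommRing R] [IsNoetherianRing R]
    (p : ℕ) [Fact p.Prime] [CharP R p] (a : Ideal R) (ha : a.IsPerfect) :
    a.cohomologicalDimension = a.height := by
  have hne : a ≠ ⊤ := ne_top_of_isPerfect ha
  obtain ⟨rs, hreg, hrs, hgrade⟩ := exists_isRegular_length_eq_grade hne
  have hpd : projectiveDimension (ModuleCat.of R (R ⧸ a)) = (rs.length : ℕ) := by
    rw [ha, hgrade]
    rfl
  have hpd_le : HasProjectiveDimensionLE (ModuleCat.of R (R ⧸ a)) rs.length :=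
    (projectiveDimension_le_iff _ _).mp hpd.le
  rw [cohomologicalDimension_eq_length_of_isWeaklyRegular p hrs hreg.toIsWeaklyRegular hpd,
    height_eq_length_of_isWeaklyRegular p hne hrs hreg.toIsWeaklyRegular hpd_le]
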